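/- Let $\mathbb D=\{z\in\mathbb C:|z|<1\}$ and let $\mathcal A$ be the class of analytic functions $f$ on $\mathbb D$ with $f(0)=0$, $f'(0)=1$. Let $S^*$ be the class of univalent $f\in\mathcal A$ such that $f(\mathbb D)$ is starlike with respect to $0$. For $0\le\xi\le1$ let $M(\xi)$ be the class of $F\in\mathcal A$ with $$\operatorname{Re}\frac{\xi z(zF'(z))'+(1-\xi)zF'(z)}{\xi zF'(z)+(1-\xi)F(z)}>0,\qquad z\in\mathbb D$$ (the quotient is read as its limit $1$ at $z=0$). For $\alpha,\gamma\ge0$ and $\beta<1$ let $W_\beta(\alpha,\gamma)$ be the class of $f\in\mathcal A$ for which there is $\phi\in\mathbb R$ with $$\operatorname{Re}\Big(e^{i\phi}\Big((1-\alpha+2\gamma)\frac{f(z)}{z}+(\alpha-2\gamma)f'(z)+\gamma zf''(z)-\beta\Big)\Big)>0,\qquad z\in\mathbb D$$ (with $f(z)/z$ read as $1$ at $z=0$). Let $\lambda:[0,1]\to[0,\infty)$ be integrable with $\int_0^1\lambda(t)\,dt=1$, and for $f\in\mathcal A$ put $V_\lambda(f)(z)=\int_0^1\lambda(t)\frac{f(tz)}{t}\,dt$.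 Let $\mu,\nu>0$ satisfy $\mu+\nu=\alpha-\gamma$ and $\mu\nu=\gamma$, and put, for $0<t\le1$, $$\Lambda_\nu(t)=\int_t^1\frac{\lambda(x)}{x^{1/\nu}}\,dx,\qquad \Pi_{\mu,\nu}(t)=\int_t^1\Lambda_\nu(x)\,x^{1/\nu-1-1/\mu}\,dx .$$ Let $g$ and $q$ be the continuous functions on $[0,1]$ with $g(0)=q(0)=1$ that satisfy on $(0,1)$ $$\frac{d}{dt}\big(t^{1/\nu}(1+g(t))\big)=\frac{2}{\mu\nu}t^{1/\nu-1}\int_0^1\frac{s^{1/\mu-1}}{(1+st)^2}\,ds,\qquad \frac{d}{dt}\big(t^{1/\nu}q(t)\big)=\frac{1}{\mu\nu}t^{1/\nu-1}\int_0^1s^{1/\mu-1}\frac{1-st}{(1+st)^3}\,ds .$$ Let $0\le\xi\le1$ and let $\beta<1$ satisfy $$\frac{\beta}{1-\beta}=-\int_0^1\lambda(t)\big[(1-\xi)g(t)+\xi(2q(t)-1)\big]\,dt .$$ Assume that $t^{1/\nu}\Lambda_\nu(t)\to0$ and $t^{1/\mu}\Pi_{\mu,\nu}(t)\to0$ as $t\to0^+$.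 For $|\epsilon|=1$ let $h_\epsilon(z)=\dfrac{z\big(1+\frac{\epsilon-1}{2}z\big)}{(1-z)^2}$, and for $h=h_\epsilon$ let $$N_{\Pi_{\mu,\nu}}(h)=\inf_{z\in\mathbb D}\int_0^1t^{1/\mu-1}\Pi_{\mu,\nu}(t)\,\mathcal L_{\xi,z}(t)\,dt\in[-\infty,\infty),$$ $$\mathcal L_{\xi,z}(t)=(1-\xi)\Big(\operatorname{Re}\frac{h(tz)}{tz}-\frac1{(1+t)^2}\Big)+\xi\Big(\operatorname{Re}h'(tz)-\frac{1-t}{(1+t)^3}\Big)$$ (with $h(w)/w$ read as $1$ at $w=0$). Then: 1. $V_\lambda(W_\beta(\alpha,\gamma))\subset M(\xi)$ if and only if $N_{\Pi_{\mu,\nu}}(h_\epsilon)\ge0$ for every $\epsilon$ with $|\epsilon|=1$. 2. For every $f\in\mathcal A$ and $F=V_\lambda(f)$: $F\in M(\xi)$ if and only if $\xi zF'+(1-\xi)F\in S^*$. (So the inclusion in 1 is equivalent to $\xi zF'+(1-\xi)F\in S^*$ for all $F\in V_\lambda(W_\beta(\alpha,\gamma))$.) 3. The value of $\beta$ is sharp: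 for every $\beta'<\beta$, $V_\lambda(W_{\beta'}(\alpha,\gamma))\not\subset M(\xi)$. -/

import Mathlib

open Set Filter Topology MeasureTheory

namespace Pascu

noncomputable section

/-- The class `𝒜`: analytic functions on the open unit disc with `f 0 = 0`, `f' 0 = 1`. -/
def ClassA : Set (ℂ → ℂ) :=
  {f | DifferentiableOn ℂ f (Metric.ball 0 1) ∧ f 0 = 0 ∧ deriv f 0 = 1}

/-- The class `S*`: normalized univalent functions on the unit disc whose image is starlike with
respect to the origin. -/
def Starlike : Set (ℂ → ℂ) :=
  {f | f ∈ ClassA ∧ InjOn f (Metric.ball 0 1) ∧ StarConvex ℝ (0 : ℂ) (f '' Metric.ball 0 1)}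

/-- `K = ξ z F' + (1 - ξ) F`. -/
def pascuComb (ξ : ℝ) (F : ℂ → ℂ) (z : ℂ) : ℂ :=
  (ξ : ℂ) * (z * deriv F z) + (1 - (ξ : ℂ)) * F z

/-- The Pascu class `M(ξ)`. The quotient has a removable singularity with value `1` at `z = 0`, so
the inequality is imposed at the other points of the disc. There it forces the denominator to be
nonzero, since `x / 0 = 0` has real part `0`. -/
def ClassM (ξ : ℝ) : Set (ℂ → ℂ) :=
  {F | F ∈ ClassA ∧ ∀ z ∈ Metric.ball (0 : ℂ) 1, z ≠ 0 →
    0 < (((ξ : ℂ) * (z * deriv (fun w => w * deriv F w) z) + (1 - (ξ : ℂ)) * (z * deriv F z)) /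
      ((ξ : ℂ) * (z * deriv F z) + (1 - (ξ : ℂ)) * F z)).re}

/-- The class `W_β(α, γ)`. For `f 0 = 0`, `dslope f 0 z` is `f z / z` for `z ≠ 0` and it is the
limit `f' 0` of this quotient for `z = 0`. -/
def ClassW (α γ β : ℝ) : Set (ℂ → ℂ) :=
  {f | f ∈ ClassA ∧ ∃ φ : ℝ, ∀ z ∈ Metric.ball (0 : ℂ) 1,
    0 < (Complex.exp (φ * Complex.I) *
      ((1 - α + 2 * γ : ℂ) * dslope f 0 z + (α - 2 * γ : ℂ) * deriv f z
        + (γ : ℂ) * z * deriv (deriv f) z - (β : ℂ))).re}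

/-- The integral transform `V_λ(f)(z) = ∫₀¹ λ(t) f(tz)/t dt`. -/
def V (lam : ℝ → ℝ) (f : ℂ → ℂ) (z : ℂ) : ℂ :=
  ∫ t in (0 : ℝ)..1, (lam t : ℂ) * (f ((t : ℂ) * z) / (t : ℂ))

/-- `Λ_ν(t) = ∫ₜ¹ λ(x) / x^(1/ν) dx`. -/
def Lam (lam : ℝ → ℝ) (ν t : ℝ) : ℝ :=
  ∫ x in t..1, lam x / x ^ (1 / ν)

/-- `Π_{μ,ν}(t) = ∫ₜ¹ Λ_ν(x) x^(1/ν - 1 - 1/μ) dx`. -/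
def PiFun (lam : ℝ → ℝ) (μ ν t : ℝ) : ℝ :=
  ∫ x in t..1, Lam lam ν x * x ^ (1 / ν - 1 - 1 / μ)

/-- `h(z) = z (1 + (ε - 1) z / 2) / (1 - z)²`. -/
def hfun (ε z : ℂ) : ℂ :=
  z * (1 + (ε - 1) / 2 * z) / (1 - z) ^ 2

/-- `L_{ξ,z}(t)`, for a function `h` with `h 0 = 0`; as above `dslope h 0 w` is `h w / w`, with its
limit at `w = 0`. -/
def L (ξ : ℝ) (h : ℂ → ℂ) (z : ℂ) (t : ℝ) : ℝ :=
  (1 - ξ) * ((dslope h 0 ((t : ℂ) * z)).re - 1 / (1 + t) ^ 2)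
    + ξ * ((deriv h ((t : ℂ) * z)).re - (1 - t) / (1 + t) ^ 3)

/-- `N_Π(h)`, the infimum over the unit disc. It may be `-∞`, so it is an extended real. -/
def NPi (lam : ℝ → ℝ) (μ ν ξ : ℝ) (h : ℂ → ℂ) : EReal :=
  ⨅ z ∈ Metric.ball (0 : ℂ) 1,
    ((∫ t in (0 : ℝ)..1, t ^ (1 / μ - 1) * PiFun lam μ ν t * L ξ h z t : ℝ) : EReal)

/-- `g` is the solution on `[0,1]` of
`(t^(1/ν) (1 + g(t)))' = 2/(μν) t^(1/ν-1) ∫₀¹ s^(1/μ-1) / (1+st)² ds`, `g(0) = 1`. -/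
structure IsSolG (μ ν : ℝ) (g : ℝ → ℝ) : Prop where
  cont : ContinuousOn g (Icc 0 1)
  init : g 0 = 1
  ode : ∀ t ∈ Ioo (0 : ℝ) 1, HasDerivAt (fun x : ℝ => x ^ (1 / ν) * (1 + g x))
    (2 / (μ * ν) * t ^ (1 / ν - 1) * ∫ s in (0 : ℝ)..1, s ^ (1 / μ - 1) / (1 + s * t) ^ 2) t

/-- `q` is the solution on `[0,1]` of
`(t^(1/ν) q(t))' = 1/(μν) t^(1/ν-1) ∫₀¹ s^(1/μ-1) (1-st) / (1+st)³ ds`, `q(0) = 1`. -/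
structure IsSolQ (μ ν : ℝ) (q : ℝ → ℝ) : Prop where
  cont : ContinuousOn q (Icc 0 1)
  init : q 0 = 1
  ode : ∀ t ∈ Ioo (0 : ℝ) 1, HasDerivAt (fun x : ℝ => x ^ (1 / ν) * q x)
    (1 / (μ * ν) * t ^ (1 / ν - 1) *
      ∫ s in (0 : ℝ)..1, s ^ (1 / μ - 1) * ((1 - s * t) / (1 + s * t) ^ 3)) t

/-! Both initial value problems have a solution, unique on `[0,1]`. -/

/-- Auxiliary averaging operator. -/
def avg (a : ℝ) (φ : ℝ → ℝ) (x : ℝ) : ℝ := ∫ s in (0 : ℝ)..1, s ^ (a - 1) * φ (s * x)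

theorem avg_bound_continuous {a M : ℝ} (ha : 0 < a) {φ : ℝ → ℝ} (hφ : Continuous φ)
    (hM : ∀ y, |φ y| ≤ M) : Continuous (avg a φ) := by
  unfold avg
  refine intervalIntegral.continuous_of_dominated_interval
    (bound := fun s => s ^ (a - 1) * M) ?_ ?_ ?_ ?_
  · intro x
    refine Measurable.aestronglyMeasurable ?_
    have : Measurable fun s : ℝ => s ^ (a - 1) := by fun_prop
    exact this.mul (by fun_prop)
  · intro x
    refine Eventually.of_forall fun s hs => ?_
    rw [uIoc_of_le zero_le_one] at hs
    rw [norm_mul, Real.norm_eq_abs, Real.norm_eq_abs, abs_of_nonneg (Real.rpow_nonneg hs.1.le _)]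
    exact mul_le_mul_of_nonneg_left (hM _) (Real.rpow_nonneg hs.1.le _)
  · exact (intervalIntegral.intervalIntegrable_rpow' (by linarith)).mul_const M
  · exact Eventually.of_forall fun s _ => by fun_prop

theorem avg_bounded {a M : ℝ} (ha : 0 < a) {φ : ℝ → ℝ}
    (hM : ∀ y, |φ y| ≤ M) (x : ℝ) : |avg a φ x| ≤ ∫ s in (0 : ℝ)..1, s ^ (a - 1) * M := by
  unfold avg
  rw [← Real.norm_eq_abs]
  refine intervalIntegral.norm_integral_le_of_norm_le zero_le_one ?_
    ((intervalIntegral.intervalIntegrable_rpow' (by linarith)).mul_const M)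
  refine Eventually.of_forall fun s hs => ?_
  rw [norm_mul, Real.norm_eq_abs, Real.norm_eq_abs, abs_of_nonneg (Real.rpow_nonneg hs.1.le _)]
  exact mul_le_mul_of_nonneg_left (hM _) (Real.rpow_nonneg hs.1.le _)

theorem avg_zero {a : ℝ} (ha : 0 < a) (φ : ℝ → ℝ) : avg a φ 0 = φ 0 / a := by
  have h : (∫ s in (0 : ℝ)..1, s ^ (a - 1)) = 1 / a := by
    rw [integral_rpow (Or.inl (by linarith))]
    simp [Real.zero_rpow ha.ne']
  simp only [avg, mul_zero, intervalIntegral.integral_mul_const, h]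
  ring

theorem avg_eq {a : ℝ} {φ : ℝ → ℝ} {x : ℝ} (hx : 0 < x) :
    x ^ a * avg a φ x = ∫ y in (0 : ℝ)..x, y ^ (a - 1) * φ y := by
  have h := intervalIntegral.smul_integral_comp_mul_right
    (a := 0) (b := 1) (fun y : ℝ => y ^ (a - 1) * φ y) x
  rw [zero_mul, one_mul] at h
  rw [← h, avg, smul_eq_mul, ← intervalIntegral.integral_const_mul,
    ← intervalIntegral.integral_const_mul]
  refine intervalIntegral.integral_congr fun s hs => ?_
  rw [uIcc_of_le zero_le_one] at hs
  rw [Real.mul_rpow hs.1 hx.le]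
  have : x ^ a = x * x ^ (a - 1) := by
    rw [Real.rpow_sub_one hx.ne']; field_simp
  rw [this]; ring

theorem avg_hasDerivAt {a : ℝ} (ha : 0 < a) {φ : ℝ → ℝ} (hφ : Continuous φ) {x : ℝ} (hx : 0 < x) :
    HasDerivAt (fun y : ℝ => y ^ a * avg a φ y) (x ^ (a - 1) * φ x) x := by
  have hm : StronglyMeasurable fun y : ℝ => y ^ (a - 1) * φ y := by
    refine Measurable.stronglyMeasurable ?_
    have : Measurable fun s : ℝ => s ^ (a - 1) := by fun_prop
    exact this.mul (by fun_prop)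
  have hi : IntervalIntegrable (fun y : ℝ => y ^ (a - 1) * φ y) volume 0 x :=
    (intervalIntegral.intervalIntegrable_rpow' (by linarith)).mul_continuousOn hφ.continuousOn
  have hc : ContinuousAt (fun y : ℝ => y ^ (a - 1) * φ y) x :=
    (Real.continuousAt_rpow_const x (a - 1) (Or.inl hx.ne')).mul hφ.continuousAt
  refine (intervalIntegral.integral_hasDerivAt_right hi
    hm.stronglyMeasurableAtFilter hc).congr_of_eventuallyEq ?_
  filter_upwards [lt_mem_nhds hx] with y hy using avg_eq hy

theorem exists_isSolG {μ ν : ℝ} (hμ : 0 < μ) (hν : 0 < ν) : ∃ g, IsSolG μ ν g := by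
  have ha : 0 < 1 / ν := by positivity
  have hb : 0 < 1 / μ := by positivity
  set φ : ℝ → ℝ := fun y => 1 / (1 + |y|) ^ 2 with hφd
  have hφ : Continuous φ := by
    refine continuous_const.div (by fun_prop) fun y => ?_
    positivity
  have hM : ∀ y, |φ y| ≤ 1 := fun y => by
    rw [hφd, abs_of_nonneg (by positivity), div_le_one (by positivity)]
    nlinarith [abs_nonneg y]
  have hc := avg_bound_continuous hb hφ hM
  have hc2 := avg_bound_continuous ha hc (avg_bounded hb hM)
  refine ⟨fun t => 2 / (μ * ν) * avg (1 / ν) (avg (1 / μ) φ) t - 1, ?_, ?_, ?_⟩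
  · exact ((continuous_const.mul hc2).sub continuous_const).continuousOn
  · simp only [avg_zero ha, avg_zero hb, hφd]
    field_simp
    norm_num
  · intro t ht
    have h := (avg_hasDerivAt ha hc ht.1).const_mul (2 / (μ * ν))
    have e : avg (1 / μ) φ t = ∫ s in (0 : ℝ)..1, s ^ (1 / μ - 1) / (1 + s * t) ^ 2 := by
      refine intervalIntegral.integral_congr fun s hs => ?_
      rw [uIcc_of_le zero_le_one] at hs
      simp only [hφd, abs_of_nonneg (mul_nonneg hs.1 ht.1.le)]
      ring
    rw [e, ← mul_assoc] at h
    refine h.congr_of_eventuallyEq (Eventually.of_forall fun y => ?_)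
    ring

theorem exists_isSolQ {μ ν : ℝ} (hμ : 0 < μ) (hν : 0 < ν) : ∃ q, IsSolQ μ ν q := by
  have ha : 0 < 1 / ν := by positivity
  have hb : 0 < 1 / μ := by positivity
  set φ : ℝ → ℝ := fun y => (1 - |y|) / (1 + |y|) ^ 3 with hφd
  have hφ : Continuous φ := by
    refine Continuous.div (by fun_prop) (by fun_prop) fun y => ?_
    positivity
  have hM : ∀ y, |φ y| ≤ 1 := fun y => by
    have h0 := abs_nonneg y
    have h1 : 0 < (1 + |y|) ^ 3 := by positivity
    have h2 : 1 + |y| ≤ (1 + |y|) ^ 3 := le_self_pow₀ (by linarith) (by norm_num)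
    rw [hφd, abs_div, abs_of_pos h1, div_le_one h1]
    refine le_trans ?_ h2
    rw [abs_le]
    constructor <;> linarith
  have hc := avg_bound_continuous hb hφ hM
  have hc2 := avg_bound_continuous ha hc (avg_bounded hb hM)
  refine ⟨fun t => 1 / (μ * ν) * avg (1 / ν) (avg (1 / μ) φ) t, ?_, ?_, ?_⟩
  · exact (continuous_const.mul hc2).continuousOn
  · simp only [avg_zero ha, avg_zero hb, hφd]
    field_simp
    norm_num
  · intro t ht
    have h := (avg_hasDerivAt ha hc ht.1).const_mul (1 / (μ * ν))
    have e : avg (1 / μ) φ t =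
        ∫ s in (0 : ℝ)..1, s ^ (1 / μ - 1) * ((1 - s * t) / (1 + s * t) ^ 3) := by
      refine intervalIntegral.integral_congr fun s hs => ?_
      rw [uIcc_of_le zero_le_one] at hs
      simp only [hφd, abs_of_nonneg (mul_nonneg hs.1 ht.1.le)]
    rw [e, ← mul_assoc] at h
    refine h.congr_of_eventuallyEq (Eventually.of_forall fun y => ?_)
    ring

/-- Continuous functions on `[0,1]` with the same derivative of `t^a u(t)` on `(0,1)`, `a > 0`,
agree. -/
theorem eqOn_of_hasDerivAt {a : ℝ} (ha : 0 < a) {u v r : ℝ → ℝ}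
    (hu : ContinuousOn u (Icc 0 1)) (hv : ContinuousOn v (Icc 0 1))
    (du : ∀ t ∈ Ioo (0 : ℝ) 1, HasDerivAt (fun x : ℝ => x ^ a * u x) (r t) t)
    (dv : ∀ t ∈ Ioo (0 : ℝ) 1, HasDerivAt (fun x : ℝ => x ^ a * v x) (r t) t) :
    EqOn u v (Ioc 0 1) := by
  intro t ht
  have hp : ContinuousOn (fun x : ℝ => x ^ a) (Icc 0 t) :=
    (Real.continuous_rpow_const ha.le).continuousOn
  have hs : Icc 0 t ⊆ Icc (0 : ℝ) 1 := Icc_subset_Icc_right ht.2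
  obtain ⟨c, hc, h⟩ := exists_hasDerivAt_eq_slope
    (fun x : ℝ => x ^ a * u x - x ^ a * v x) (fun _ => 0) ht.1
    ((hp.mul (hu.mono hs)).sub (hp.mul (hv.mono hs)))
    (fun x hx => by
      have h := (du x ⟨hx.1, hx.2.trans_le ht.2⟩).sub (dv x ⟨hx.1, hx.2.trans_le ht.2⟩)
      rwa [sub_self] at h)
  have h1 : 0 < t ^ a := Real.rpow_pos_of_pos ht.1 a
  rw [Real.zero_rpow ha.ne', sub_zero, eq_comm, div_eq_zero_iff] at h
  have h2 : t ^ a * (u t - v t) = 0 := by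
    have := h.resolve_right ht.1.ne'
    linarith
  linarith [(mul_eq_zero.1 h2).resolve_left h1.ne']

end

end Pascu

/-! Everything is read off Taylor coefficients. If `f` has coefficients `a`, the operator defining
W_β(α,γ) has coefficients (1+μm)(1+νm)a_{m+1}, because μ+ν = α-γ and μν = γ. Put F = V_λ(f) and K =
ξzF' + (1-ξ)F. The Pascu quotient is zK'/K, so M(ξ) says Re zK'/K > 0, the analytic form of
starlikeness of K (`starlike_iff`); this is assertion 2.

A Möbius map between the imaginary axis and the unit circle rewrites the condition once more: for
|ε| = 1 the convolution K * h_ε has no zero in the punctured disc. Now (K * h_ε)/z is the Hadamard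
product of the operator applied to `f` with a fixed function `psi` (`exists_pascuConv_eq`). Fubini,
used twice, computes the moments of t^(1/μ-1)Π(t) and exhibits `psi` as 1/(μν) times the integral of
(1-ξ)h(tz)/(tz) + ξh'(tz) against that weight (`hasPS_psi`). The same computation turns the equation
for β into the statement that the values of the Koebe function at -t integrate to μν·c with c = 1 -
1/(2(1-β)) (`integral_koebeMin`). Hence N_Π(h_ε) ≥ 0 means Re `psi` ≥ c on the disc.

What remains is a duality between W_β and this half-plane. If Re `psi` > c, then the Hadamard
product with a function H such that Re e^{iφ}(H-β) > 0 cannot vanish (`lt_re_of_hasSum_hadamard`).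
If Re `psi` goes below c, it equals c at some w, and an explicit `f` in W_β, with operator 1 +
z/(d(1-z)) and d = 1 - psi(w), produces a zero at w. Sharpness follows because for ε = 1 the value c
is approached as z tends to -1. -/

namespace Pascu

/-! ### Power series on the unit disc -/

/-- `f` is the sum on the unit disc of the power series with coefficients `a`. -/
def HasPS (a : ℕ → ℂ) (f : ℂ → ℂ) : Prop :=
  ∀ z ∈ Metric.ball (0 : ℂ) 1, HasSum (fun n => a n * z ^ n) (f z)

theorem exists_hasPS {f : ℂ → ℂ} (hf : DifferentiableOn ℂ f (Metric.ball 0 1)) :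
    ∃ a, HasPS a f := by
  refine ⟨fun n => (n.factorial : ℂ)⁻¹ * iteratedDeriv n f 0, fun z hz => ?_⟩
  convert! Complex.hasSum_taylorSeries_on_ball hf hz using 2 with n
  simp only [sub_zero, smul_eq_mul]
  ring

theorem ofReal_mul_mem_ball {t : ℝ} (h0 : 0 ≤ t) (h1 : t ≤ 1) {z : ℂ}
    (hz : z ∈ Metric.ball (0 : ℂ) 1) : (t : ℂ) * z ∈ Metric.ball (0 : ℂ) 1 := by
  rw [mem_ball_zero_iff] at hz ⊢
  rw [norm_mul, Complex.norm_real, Real.norm_of_nonneg h0]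
  nlinarith [norm_nonneg z]

theorem ofReal_mem_ball {r : ℝ} (h0 : 0 ≤ r) (h1 : r < 1) : (r : ℂ) ∈ Metric.ball (0 : ℂ) 1 := by
  rw [mem_ball_zero_iff, Complex.norm_real, Real.norm_of_nonneg h0]
  exact h1

namespace HasPS

variable {a b : ℕ → ℂ} {f g : ℂ → ℂ}

theorem summable_norm (h : HasPS a f) {r : ℝ} (h0 : 0 ≤ r) (h1 : r < 1) :
    Summable fun n => ‖a n‖ * r ^ n := by
  refine (h r (ofReal_mem_ball h0 h1)).summable.norm.congr fun n => ?_
  rw [norm_mul, norm_pow, Complex.norm_real, Real.norm_of_nonneg h0]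

theorem congr (h : HasPS a f) (hab : ∀ n, a n = b n)
    (hfg : ∀ z ∈ Metric.ball (0 : ℂ) 1, f z = g z) : HasPS b g := fun z hz => by
  rw [← hfg z hz, ← funext hab]
  exact h z hz

theorem add (hf : HasPS a f) (hg : HasPS b g) :
    HasPS (fun n => a n + b n) (fun z => f z + g z) := fun z hz => by
  simpa only [add_mul] using (hf z hz).add (hg z hz)

theorem const_mul (c : ℂ) (hf : HasPS a f) :
    HasPS (fun n => c * a n) (fun z => c * f z) := fun z hz => by
  simpa only [mul_assoc] using (hf z hz).mul_left c

theorem apply_zero (hf : HasPS a f) : f 0 = a 0 := by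
  have h := hf 0 (by simp)
  refine h.unique ?_
  convert! hasSum_single (f := fun n => a n * (0 : ℂ) ^ n) 0 ?_ using 1
  · simp
  · intro n hn
    simp [hn]

theorem eqOn (hf : HasPS a f) (hg : HasPS a g) : EqOn f g (Metric.ball 0 1) :=
  fun z hz => (hf z hz).unique (hg z hz)

theorem differentiableOn (hf : HasPS a f) : DifferentiableOn ℂ f (Metric.ball 0 1) := by
  intro z hz
  have hz' := mem_ball_zero_iff.1 hz
  obtain ⟨r, hr, hr1⟩ := exists_between hz'
  have hr0 : 0 ≤ r := (norm_nonneg z).trans hr.le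
  have hd : DifferentiableOn ℂ (fun w => ∑' n, a n * w ^ n) (Metric.ball 0 r) :=
    Complex.differentiableOn_tsum_of_summable_norm (hf.summable_norm hr0 hr1)
      (fun n => by fun_prop) Metric.isOpen_ball fun n w hw => by
        rw [norm_mul, norm_pow]
        gcongr
        exact (mem_ball_zero_iff.1 hw).le
  have hzr : Metric.ball (0 : ℂ) r ∈ 𝓝 z :=
    Metric.isOpen_ball.mem_nhds (mem_ball_zero_iff.2 hr)
  refine ((hd.differentiableAt hzr).congr_of_eventuallyEq ?_).differentiableWithinAt
  filter_upwards [hzr] with w hw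
  exact ((hf w (Metric.ball_subset_ball hr1.le hw)).tsum_eq).symm

theorem deriv (hf : HasPS a f) : HasPS (fun n => ((n : ℂ) + 1) * a (n + 1)) (_root_.deriv f) := by
  intro z hz
  have hz' := mem_ball_zero_iff.1 hz
  obtain ⟨r, hr, hr1⟩ := exists_between hz'
  have hr0 : 0 ≤ r := (norm_nonneg z).trans hr.le
  have hzr : z ∈ Metric.ball (0 : ℂ) r := mem_ball_zero_iff.2 hr
  have hd := Complex.hasSum_deriv_of_summable_norm (F := fun n w => a n * w ^ n)
    (hf.summable_norm hr0 hr1)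
      (fun n => by fun_prop) Metric.isOpen_ball (fun n w hw => by
        rw [norm_mul, norm_pow]
        gcongr
        exact (mem_ball_zero_iff.1 hw).le) hzr
  have e : _root_.deriv (fun w => ∑' n, a n * w ^ n) z = _root_.deriv f z := by
    refine Filter.EventuallyEq.deriv_eq ?_
    filter_upwards [Metric.isOpen_ball.mem_nhds hzr] with w hw
    exact (hf w (Metric.ball_subset_ball hr1.le hw)).tsum_eq
  rw [e, ← hasSum_nat_add_iff' 1] at hd
  simp only [Finset.range_one, Finset.sum_singleton, pow_zero, mul_one, deriv_const,
    sub_zero] at hd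
  convert! hd using 2 with n
  rw [deriv_const_mul _ (by fun_prop), deriv_pow_field]
  push_cast
  ring

/-- Multiplication by `z` shifts the coefficients. -/
theorem id_mul (hf : HasPS a f) (hb0 : b 0 = 0) (hb : ∀ n, b (n + 1) = a n) :
    HasPS b (fun z => z * f z) := by
  intro z hz
  rw [← hasSum_nat_add_iff' 1]
  simp only [Finset.range_one, Finset.sum_singleton, hb0, zero_mul, sub_zero, hb]
  convert! (hf z hz).mul_left z using 2 with n
  ring

theorem id_mul_deriv (hf : HasPS a f) : HasPS (fun n => (n : ℂ) * a n) (fun z => z * _root_.deriv f z) :=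
  hf.deriv.id_mul (by simp) fun n => by push_cast; rfl

theorem dslope (hf : HasPS a f) (h0 : a 0 = 0) : HasPS (fun n => a (n + 1)) (dslope f 0) := by
  intro z hz
  rcases eq_or_ne z 0 with rfl | hz0
  · have h := hf.deriv.apply_zero
    rw [dslope_same, h]
    convert! hasSum_single (f := fun n => a (n + 1) * (0 : ℂ) ^ n) 0 ?_ using 1
    · simp
    · intro n hn
      simp [hn]
  · have h := hf z hz
    rw [← hasSum_nat_add_iff' 1] at h
    rw [dslope_of_ne _ hz0, slope_def_field, hf.apply_zero, h0]
    convert! h.mul_left z⁻¹ using 1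
    · ext n
      field_simp
      ring
    · simp [h0]
      field_simp

/-- Termwise integration against a weight on `[0, 1]`. -/
theorem integral_weight (hf : HasPS a f) {w : ℝ → ℝ} (hw : IntervalIntegrable w volume 0 1) :
    HasPS (fun n => a n * ((∫ t in (0 : ℝ)..1, w t * t ^ n : ℝ) : ℂ))
      (fun z => ∫ t in (0 : ℝ)..1, (w t : ℂ) * f (t * z)) := by
  intro z hz
  have hz' := mem_ball_zero_iff.1 hz
  have h := intervalIntegral.hasSum_integral_of_dominated_convergence (μ := volume)
    (a := (0 : ℝ)) (b := 1) (F := fun n t => (w t : ℂ) * (a n * ((t : ℂ) * z) ^ n))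
    (f := fun t => (w t : ℂ) * f (t * z)) (fun n t => |w t| * (‖a n‖ * ‖z‖ ^ n)) ?_ ?_ ?_ ?_ ?_
  · convert! h using 2 with n
    have e : ((∫ t in (0 : ℝ)..1, w t * t ^ n : ℝ) : ℂ) =
      ∫ t in (0 : ℝ)..1, ((w t * t ^ n : ℝ) : ℂ) := intervalIntegral.integral_ofReal.symm
    simp only [e]
    rw [← intervalIntegral.integral_const_mul,
      ← intervalIntegral.integral_mul_const]
    refine intervalIntegral.integral_congr fun t _ => ?_
    simp only [mul_pow]
    push_cast
    ring
  · intro n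
    have h1 : AEStronglyMeasurable w (volume.restrict (uIoc 0 1)) := by
      rw [uIoc_of_le zero_le_one]
      exact hw.1.aestronglyMeasurable
    exact (Complex.continuous_ofReal.comp_aestronglyMeasurable h1).mul
      (Continuous.aestronglyMeasurable (by fun_prop))
  · refine fun n => Eventually.of_forall fun t ht => ?_
    rw [uIoc_of_le zero_le_one] at ht
    rw [norm_mul, norm_mul, norm_pow, norm_mul, Complex.norm_real, Complex.norm_real,
      Real.norm_eq_abs, Real.norm_of_nonneg ht.1.le]
    have := mul_nonneg ht.1.le (norm_nonneg z)
    gcongr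
    nlinarith [norm_nonneg z, ht.2]
  · exact Eventually.of_forall fun t _ => (hf.summable_norm (norm_nonneg z) hz').mul_left _
  · simp only [tsum_mul_left]
    exact hw.abs.mul_const _
  · refine Eventually.of_forall fun t ht => ?_
    rw [uIoc_of_le zero_le_one] at ht
    exact (hf _ (ofReal_mul_mem_ball ht.1.le ht.2 hz)).mul_left _

end HasPS

/-- Bounded coefficients define a power series on the disc. -/
theorem hasPS_of_bounded {a : ℕ → ℂ} {C : ℝ} (ha : ∀ n, ‖a n‖ ≤ C) :
    HasPS a (fun z => ∑' n, a n * z ^ n) := by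
  intro z hz
  have hz' := mem_ball_zero_iff.1 hz
  refine Summable.hasSum (Summable.of_norm_bounded
    ((summable_geometric_of_lt_one (norm_nonneg z) hz').mul_left C) fun n => ?_)
  rw [norm_mul, norm_pow]
  gcongr
  exact ha n

/-! ### Starlikeness and the condition Re zK'/K > 0 -/

/-- The strict form of the minimum principle for the real part. -/
theorem re_lt_of_re_le {G : ℂ → ℂ} {c : ℝ} (hG : DifferentiableOn ℂ G (Metric.ball 0 1))
    (h : ∀ z ∈ Metric.ball (0 : ℂ) 1, c ≤ (G z).re) (h0 : c < (G 0).re) :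
    ∀ z ∈ Metric.ball (0 : ℂ) 1, c < (G z).re := by
  intro z hz
  refine (h z hz).lt_of_ne fun he => ?_
  -- Since |exp(-G)| = exp(-Re G), a minimum of Re G is a maximum of this modulus, which is then
  -- constant on the disc; the value at 0 excludes that.
  have hm : IsMaxOn (norm ∘ fun w => Complex.exp (-G w)) (Metric.ball 0 1) z := by
    intro w hw
    simp only [Function.comp, mem_ofPred_eq, Complex.norm_exp, Complex.neg_re, Real.exp_le_exp]
    have := h w hw
    linarith
  have h1 := Complex.norm_eqOn_of_isPreconnected_of_isMaxOn
    (convex_ball (0 : ℂ) 1).isPreconnected Metric.isOpen_ball hG.neg.cexp hz hm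
    (Metric.mem_ball_self one_pos)
  simp only [Function.comp, Function.const, Complex.norm_exp, Pi.neg_apply, Complex.neg_re,
    Real.exp_eq_exp] at h1
  linarith

/-- Noshiro–Warschawski: difference quotients inherit the positive real part of the derivative. -/
theorem re_slope_pos {G G' : ℂ → ℂ} {S : Set ℂ} (hS : Convex ℝ S)
    (hG : ∀ z ∈ S, HasDerivAt G (G' z) z) (hpos : ∀ z ∈ S, 0 < (G' z).re)
    {a b : ℂ} (ha : a ∈ S) (hb : b ∈ S) (hab : a ≠ b) : 0 < ((G a - G b) / (a - b)).re := by
  have hne : a - b ≠ 0 := sub_ne_zero.2 hab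
  have hmem : ∀ s ∈ Icc (0 : ℝ) 1, b + s * (a - b) ∈ S := fun s hs => by
    simpa using hS.add_smul_sub_mem hb ha hs
  have hd : ∀ s ∈ Icc (0 : ℝ) 1, HasDerivAt (fun s : ℝ => (G (b + s * (a - b)) / (a - b)).re)
      (G' (b + s * (a - b))).re s := fun s hs => by
    have h1 : HasDerivAt (fun s : ℂ => b + s * (a - b)) (a - b) (s : ℂ) := by
      simpa using ((hasDerivAt_id (s : ℂ)).mul_const (a - b)).const_add b
    have h2 := ((hG _ (hmem s hs)).comp (s : ℂ) h1).div_const (a - b)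
    rw [mul_div_cancel_right₀ _ hne] at h2
    exact h2.real_of_complex
  obtain ⟨s, hs, h⟩ := exists_hasDerivAt_eq_slope _ _ zero_lt_one
    (fun s hs => (hd s hs).continuousAt.continuousWithinAt)
    (fun s hs => hd s (Ioo_subset_Icc_self hs))
  have h3 := hpos _ (hmem s (Ioo_subset_Icc_self hs))
  rw [h] at h3
  simpa [← Complex.sub_re, ← sub_div] using h3

theorem apply_ne_zero_of_re_pos {K : ℂ → ℂ}
    (hpos : ∀ z ∈ Metric.ball (0 : ℂ) 1, z ≠ 0 → 0 < (z * deriv K z / K z).re)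
    {z : ℂ} (hz : z ∈ Metric.ball (0 : ℂ) 1) (hz0 : z ≠ 0) : K z ≠ 0 := fun h => by
  simpa [h] using hpos z hz hz0

theorem eq_mul_dslope {K : ℂ → ℂ} (h0 : K 0 = 0) (z : ℂ) : K z = z * dslope K 0 z := by
  have h := sub_smul_dslope K 0 z
  rw [sub_zero, h0, sub_zero, smul_eq_mul] at h
  exact h.symm

/-- A logarithm of `K ∘ exp` on the left half-plane. -/
theorem exists_log_comp_exp {K : ℂ → ℂ} (hK : K ∈ ClassA)
    (hpos : ∀ z ∈ Metric.ball (0 : ℂ) 1, z ≠ 0 → 0 < (z * deriv K z / K z).re) :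
    ∃ G : ℂ → ℂ,
      (∀ ζ : ℂ, ζ.re < 0 →
        HasDerivAt G (Complex.exp ζ * deriv K (Complex.exp ζ) / K (Complex.exp ζ)) ζ) ∧
      (∀ ζ : ℂ, ζ.re < 0 → Complex.exp (G ζ) = K (Complex.exp ζ)) ∧
      ∀ (ζ : ℂ) (n : ℤ), G (ζ + n * (2 * Real.pi * Complex.I)) =
        G ζ + n * (2 * Real.pi * Complex.I) := by
  obtain ⟨hd, h0, h1⟩ := hK
  have hball : Metric.ball (0 : ℂ) 1 ∈ 𝓝 (0 : ℂ) := Metric.ball_mem_nhds _ one_pos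
  set D := dslope K 0 with hD
  have hDd : DifferentiableOn ℂ D (Metric.ball 0 1) := (Complex.differentiableOn_dslope hball).2 hd
  have hKD : ∀ z, K z = z * D z := eq_mul_dslope h0
  have hD0 : D 0 = 1 := by rw [hD, dslope_same, h1]
  have hDne : ∀ z ∈ Metric.ball (0 : ℂ) 1, D z ≠ 0 := fun z hz => by
    rcases eq_or_ne z 0 with rfl | hz0
    · simp [hD0]
    · have := apply_ne_zero_of_re_pos hpos hz hz0
      rw [hKD] at this
      exact right_ne_zero_of_mul this
  have hDat : ∀ z ∈ Metric.ball (0 : ℂ) 1, HasDerivAt D (deriv D z) z := fun z hz =>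
    (hDd.differentiableAt (Metric.isOpen_ball.mem_nhds hz)).hasDerivAt
  obtain ⟨L, hL0, hL⟩ := ((hDd.deriv Metric.isOpen_ball).div hDd hDne).isExactOn_ball.with_val_at
    0 0
  have hexpL : ∀ z ∈ Metric.ball (0 : ℂ) 1, Complex.exp (L z) = D z := fun z hz => by
    have hder : ∀ w ∈ Metric.ball (0 : ℂ) 1,
        HasDerivAt (fun w => D w * Complex.exp (-L w)) 0 w := fun w hw => by
      convert! (hDat w hw).mul ((hL w hw).neg.cexp) using 1
      simp only [Pi.div_apply, Pi.neg_apply]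
      field_simp [hDne w hw]
      ring
    have := Metric.isOpen_ball.is_const_of_deriv_eq_zero (convex_ball (0 : ℂ) 1).isPreconnected
      (fun w hw => (hder w hw).differentiableAt.differentiableWithinAt)
      (fun w hw => (hder w hw).deriv) hz (Metric.mem_ball_self one_pos)
    simp only [hD0, hL0, neg_zero, Complex.exp_zero, mul_one] at this
    rw [Complex.exp_neg] at this
    field_simp at this
    exact this.symm
  have hmem : ∀ ζ : ℂ, ζ.re < 0 → Complex.exp ζ ∈ Metric.ball (0 : ℂ) 1 := fun ζ hζ => by
    rw [mem_ball_zero_iff, Complex.norm_exp]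
    simpa using hζ
  -- `K z = z * D z` with `D` zero-free and `L` a logarithm of `D`; the summand `ζ` is the logarithm
  -- of the factor z. As `L ∘ exp` has period 2πi, only that summand sees the shift.
  refine ⟨fun ζ => ζ + L (Complex.exp ζ), fun ζ hζ => ?_, fun ζ hζ => ?_, fun ζ n => ?_⟩
  · have hz := hmem ζ hζ
    convert! (hasDerivAt_id ζ).add ((hL _ hz).comp ζ (Complex.hasDerivAt_exp ζ)) using 1
    have hKd : HasDerivAt K (1 * D (Complex.exp ζ) + Complex.exp ζ * deriv D (Complex.exp ζ))
        (Complex.exp ζ) :=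
      ((hasDerivAt_id _).mul (hDat _ hz)).congr_of_eventuallyEq (Eventually.of_forall hKD)
    rw [hKd.deriv, hKD]
    have := Complex.exp_ne_zero ζ
    have := hDne _ hz
    simp only [Pi.div_apply]
    field_simp
  · rw [Complex.exp_add, hexpL _ (hmem ζ hζ), ← hKD]
  · simp only [Complex.exp_periodic.int_mul n ζ]
    ring

/-- Moving towards the origin on a ray in the image decreases the modulus of the argument. -/
theorem norm_lt_or_eq_of_apply_eq {K : ℂ → ℂ} (hK : K ∈ ClassA)
    (hpos : ∀ z ∈ Metric.ball (0 : ℂ) 1, z ≠ 0 → 0 < (z * deriv K z / K z).re)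
    {z w : ℂ} (hz : z ∈ Metric.ball (0 : ℂ) 1) (hw : w ∈ Metric.ball (0 : ℂ) 1)
    (hz0 : z ≠ 0) (hw0 : w ≠ 0) {t : ℝ} (ht0 : 0 < t) (ht1 : t ≤ 1) (h : K w = t * K z) :
    (t < 1 ∧ ‖w‖ < ‖z‖) ∨ w = z := by
  obtain ⟨G, hG, hexp, hper⟩ := exists_log_comp_exp hK hpos
  have hlog : ∀ x : ℂ, x ∈ Metric.ball (0 : ℂ) 1 → x ≠ 0 → (Complex.log x).re < 0 :=
    fun x hx hx0 => by
      rw [Complex.log_re]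
      exact Real.log_neg (norm_pos_iff.2 hx0) (mem_ball_zero_iff.1 hx)
  set a := Complex.log w
  set b := Complex.log z
  have ha : Complex.exp a = w := Complex.exp_log hw0
  have hb : Complex.exp b = z := Complex.exp_log hz0
  have ht : Complex.exp (Real.log t : ℝ) = t := by
    rw [← Complex.ofReal_exp, Real.exp_log ht0]
  have h1 : Complex.exp (G a) = Complex.exp ((Real.log t : ℝ) + G b) := by
    rw [Complex.exp_add, ht, hexp a (hlog w hw hw0), hexp b (hlog z hz hz0), ha, hb, h]
  obtain ⟨n, hn⟩ := Complex.exp_eq_exp_iff_exists_int.1 h1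
  -- Moving `b` by a period leaves z and the real part unchanged and absorbs the ambiguity of the
  -- logarithm, so that `G a - G b'` is exactly the real number log t ≤ 0. Positivity of the real
  -- part of the slope then forces Re a < Re b'.
  set b' := b + n * (2 * Real.pi * Complex.I) with hb'
  have hGab : G a - G b' = (Real.log t : ℝ) := by
    rw [hn, hb', hper]
    ring
  have hre : b'.re = b.re := by simp [hb']
  have heb : Complex.exp b' = z := by rw [hb', Complex.exp_periodic.int_mul n b, hb]
  rcases eq_or_ne a b' with hab | hab
  · right
    rw [← ha, hab, heb]
  left
  have hS : Convex ℝ {ζ : ℂ | ζ.re < 0} := convex_halfSpace_re_lt 0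
  have hs := re_slope_pos hS (fun ζ hζ => hG ζ hζ)
    (fun ζ (hζ : ζ.re < 0) => hpos _ (by
      rw [mem_ball_zero_iff, Complex.norm_exp]
      simpa using hζ) (Complex.exp_ne_zero ζ))
    (hlog w hw hw0) (show b'.re < 0 from hre ▸ hlog z hz hz0) hab
  rw [hGab, Complex.div_re, Complex.ofReal_re, Complex.ofReal_im, zero_mul, zero_div, add_zero]
    at hs
  have hlt : Real.log t < 0 := by
    refine (Real.log_nonpos ht0.le ht1).lt_of_ne fun h0 => ?_
    simp [h0] at hs
  refine ⟨(Real.log_neg_iff ht0).1 hlt, ?_⟩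
  have hn0 : 0 < Complex.normSq (a - b') := Complex.normSq_pos.2 (sub_ne_zero.2 hab)
  rw [div_pos_iff_of_pos_right hn0, Complex.sub_re, hre] at hs
  rw [← ha, ← hb, Complex.norm_exp, Complex.norm_exp, Real.exp_lt_exp]
  nlinarith

/-- Open mapping theorem; injectivity rules out the constant case. -/
theorem isOpen_image_of_injOn {K : ℂ → ℂ} (hK : DifferentiableOn ℂ K (Metric.ball 0 1))
    (hinj : InjOn K (Metric.ball 0 1)) {s : Set ℂ} (hs : s ⊆ Metric.ball 0 1) (ho : IsOpen s) :
    IsOpen (K '' s) := by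
  rcases (hK.analyticOnNhd Metric.isOpen_ball).is_constant_or_isOpen
    (convex_ball (0 : ℂ) 1).isPreconnected with ⟨w, hw⟩ | h
  · have h2 : ((1 / 2 : ℝ) : ℂ) ∈ Metric.ball (0 : ℂ) 1 :=
      ofReal_mem_ball (by norm_num) (by norm_num)
    have h3 := hinj (Metric.mem_ball_self one_pos) h2
      ((hw _ (Metric.mem_ball_self one_pos)).trans (hw _ h2).symm)
    norm_num at h3
  · exact h s hs ho

/-- In logarithmic coordinates K has a derivative of positive real part, so it is injective, and
preimages of points nearer to 0 on a ray have smaller modulus. A ray followed inwards from `K z`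
therefore cannot leave the image: its preimages stay in the compact disc of radius |z|. -/
theorem starlike_of_re_pos {K : ℂ → ℂ} (hK : K ∈ ClassA)
    (hpos : ∀ z ∈ Metric.ball (0 : ℂ) 1, z ≠ 0 → 0 < (z * deriv K z / K z).re) :
    K ∈ Starlike := by
  have h00 : K 0 = 0 := hK.2.1
  have hne : ∀ z ∈ Metric.ball (0 : ℂ) 1, z ≠ 0 → K z ≠ 0 := fun z hz hz0 =>
    apply_ne_zero_of_re_pos hpos hz hz0
  have hinj : InjOn K (Metric.ball 0 1) := by
    intro w hw z hz h
    rcases eq_or_ne z 0 with rfl | hz0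
    · by_contra hw0
      exact hne w hw hw0 (h.trans h00)
    rcases eq_or_ne w 0 with rfl | hw0
    · exact absurd (h.symm.trans h00) (hne z hz hz0)
    rcases norm_lt_or_eq_of_apply_eq hK hpos hz hw hz0 hw0 one_pos le_rfl (by simpa using h)
      with h1 | h1
    · exact absurd h1.1 (lt_irrefl _)
    · exact h1
  refine ⟨hK, hinj, ?_⟩
  rw [starConvex_zero_iff]
  rintro _ ⟨z, hz, rfl⟩ t ht0 ht1
  by_contra hcon
  have hz1 := mem_ball_zero_iff.1 hz
  have hz0 : z ≠ 0 := by
    rintro rfl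
    exact hcon ⟨0, hz, by simp [h00]⟩
  have hsub : Metric.closedBall (0 : ℂ) ‖z‖ ⊆ Metric.ball 0 1 :=
    Metric.closedBall_subset_ball hz1
  have hcl : IsClosed (K '' Metric.closedBall (0 : ℂ) ‖z‖) :=
    ((isCompact_closedBall _ _).image_of_continuousOn (hK.1.continuousOn.mono hsub)).isClosed
  have hcont : Continuous fun s : ℝ => s • K z := by fun_prop
  -- The image of the open disc and the complement of the image of the closed disc of radius |z| are
  -- open and cover the plane. If the segment left the image, connectedness would give a point `s •
  -- K z = K w` with |w| > |z|.
  obtain ⟨s, hs, hs1, hs2⟩ := isPreconnected_Icc (a := (0 : ℝ)) (b := 1)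
    ((fun s : ℝ => s • K z) ⁻¹' (K '' Metric.ball 0 1))
    ((fun s : ℝ => s • K z) ⁻¹' (K '' Metric.closedBall (0 : ℂ) ‖z‖)ᶜ)
    ((isOpen_image_of_injOn hK.1 hinj Subset.rfl Metric.isOpen_ball).preimage hcont)
    (hcl.isOpen_compl.preimage hcont)
    (fun s _ => by
      by_cases h : s • K z ∈ K '' Metric.closedBall (0 : ℂ) ‖z‖
      · exact Or.inl (image_mono hsub h)
      · exact Or.inr h)
    ⟨1, ⟨zero_le_one, le_rfl⟩, z, hz, by simp⟩
    ⟨t, ⟨ht0, ht1⟩, fun h => hcon (image_mono hsub h)⟩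
  refine hs2 ?_
  obtain ⟨w, hw, hwz⟩ := hs1
  refine ⟨w, ?_, hwz⟩
  rw [mem_closedBall_zero_iff]
  rcases eq_or_ne w 0 with rfl | hw0
  · simp
  have hs0 : 0 < s := hs.1.lt_of_ne fun h => hne w hw hw0 (by rw [hwz, ← h]; simp)
  rcases norm_lt_or_eq_of_apply_eq hK hpos hz hw hz0 hw0 hs0 hs.2 (by simpa using hwz)
    with h1 | h1
  · exact h1.2.le
  · rw [h1]

/-- An injective holomorphic function has no critical points. -/
theorem deriv_ne_zero_of_injOn {f : ℂ → ℂ} {U : Set ℂ} (hU : IsOpen U)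
    (hf : DifferentiableOn ℂ f U) (hinj : InjOn f U) {c : ℂ} (hc : c ∈ U) : deriv f c ≠ 0 := by
  intro hder
  have hcU : U ∈ 𝓝 c := hU.mem_nhds hc
  have hfa : AnalyticAt ℂ f c := hf.analyticAt hcU
  have hFa : AnalyticAt ℂ (fun z => f z - f c) c := hfa.sub analyticAt_const
  have htop : analyticOrderAt (fun z => f z - f c) c ≠ ⊤ := by
    rw [Ne, analyticOrderAt_eq_top]
    intro h
    have h1 : ∀ᶠ z in 𝓝 c, z = c := by
      filter_upwards [h, hcU] with z hz hzU using hinj hzU hc (sub_eq_zero.1 hz)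
    have h2 : ∃ᶠ z in 𝓝[≠] c, z = c := (h1.filter_mono nhdsWithin_le_nhds).frequently
    obtain ⟨z, hz, hz2⟩ := (h2.and_eventually self_mem_nhdsWithin).exists
    exact hz2 hz
  obtain ⟨g, hga, hg0, hfg⟩ := hFa.analyticOrderAt_ne_top.1 htop
  set n := analyticOrderNatAt (fun z => f z - f c) c
  have hn0 : n ≠ 0 := by
    intro h
    have := hfg.self_of_nhds
    simp [h] at this
    exact hg0 this.symm
  have hn1 : n ≠ 1 := by
    intro h
    have h1 : HasDerivAt (fun z => f z - f c) (1 * g c + (c - c) * deriv g c) c := by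
      refine (((hasDerivAt_id c).sub_const c).mul
        hga.differentiableAt.hasDerivAt).congr_of_eventuallyEq ?_
      filter_upwards [hfg] with z hz
      simp [hz, h]
    have h2 := (hfa.differentiableAt.hasDerivAt.sub_const (f c)).unique h1
    rw [hder] at h2
    simp at h2
    exact hg0 h2.symm
  have hnC : (n : ℂ) ≠ 0 := Nat.cast_ne_zero.2 hn0
  -- A local coordinate in which `f - f c` is a constant times the pure power φ^n. It is a local
  -- homeomorphism, so for n ≥ 2 small points differing by an n-th root of unity have distinct
  -- preimages with equal values of `f`.
  set φ : ℂ → ℂ := fun z => (z - c) * Complex.exp (Complex.log (g z / g c) / n) with hφ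
  have hsl : g c / g c ∈ Complex.slitPlane := by simp [div_self hg0]
  have hφa : AnalyticAt ℂ φ c := by
    have h1 : AnalyticAt ℂ (fun z => g z / g c) c := hga.div analyticAt_const hg0
    have h2 : AnalyticAt ℂ (fun z => Complex.log (g z / g c)) c := h1.clog hsl
    exact (analyticAt_id.sub analyticAt_const).mul (h2.div analyticAt_const hnC).cexp
  have hφd : deriv φ c = 1 := by
    have h1 : HasDerivAt φ (1 * Complex.exp (Complex.log (g c / g c) / n) + (c - c) *
        deriv (fun z => Complex.exp (Complex.log (g z / g c) / n)) c) c := by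
      refine ((hasDerivAt_id c).sub_const c).mul (DifferentiableAt.hasDerivAt ?_)
      have h2 : DifferentiableAt ℂ (fun z => Complex.log (g z / g c)) c :=
        (hga.differentiableAt.div_const _).clog hsl
      exact (h2.div_const _).cexp
    rw [h1.deriv]
    simp [div_self hg0]
  have hφ0 : φ c = 0 := by simp [hφ]
  have hmap : map φ (𝓝 c) = 𝓝 0 := by
    rw [hφa.hasStrictDerivAt.map_nhds_eq (by rw [hφd]; exact one_ne_zero), hφ0]
  have hpow : ∀ᶠ z in 𝓝 c, f z - f c = g c * φ z ^ n := by
    have hgn : ∀ᶠ z in 𝓝 c, g z ≠ 0 := hga.continuousAt.eventually_ne hg0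
    filter_upwards [hfg, hgn] with z hz hgz
    rw [hz, hφ, mul_pow, ← Complex.exp_nat_mul, mul_div_cancel₀ _ hnC,
      Complex.exp_log (div_ne_zero hgz hg0), smul_eq_mul]
    field_simp
  have himg : φ '' {z | z ∈ U ∧ f z - f c = g c * φ z ^ n} ∈ 𝓝 (0 : ℂ) := by
    rw [← hmap]
    exact image_mem_map (inter_mem hcU hpow)
  have hroot := Complex.isPrimitiveRoot_exp n hn0
  set ρ := Complex.exp (2 * Real.pi * Complex.I / n)
  have h0 : ∀ᶠ w in 𝓝 (0 : ℂ), w ∈ φ '' {z | z ∈ U ∧ f z - f c = g c * φ z ^ n} := himg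
  have h1 : ∀ᶠ w in 𝓝 (0 : ℂ), ρ * w ∈ φ '' {z | z ∈ U ∧ f z - f c = g c * φ z ^ n} := by
    have : Tendsto (fun w : ℂ => ρ * w) (𝓝 0) (𝓝 0) := by
      simpa using (continuous_const_mul ρ).tendsto (0 : ℂ)
    exact this.eventually himg
  obtain ⟨w, ⟨⟨z₁, ⟨hz₁, e₁⟩, rfl⟩, ⟨z₂, ⟨hz₂, e₂⟩, hw⟩⟩, hw0⟩ :=
    (((h0.and h1).filter_mono nhdsWithin_le_nhds).and
      (self_mem_nhdsWithin (a := (0 : ℂ)) (s := {0}ᶜ))).exists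
  have heq : f z₁ = f z₂ := by
    rw [hw, mul_pow, hroot.pow_eq_one, one_mul, ← e₁] at e₂
    linear_combination -e₂
  rw [← hinj hz₁ hz₂ heq] at hw
  have hρ : ρ = 1 := by
    have h3 : (ρ - 1) * φ z₁ = 0 := by linear_combination -hw
    rcases mul_eq_zero.1 h3 with h | h
    · exact sub_eq_zero.1 h
    · exact absurd h hw0
  exact hroot.ne_one (by omega) hρ

/-- With `k` the inverse of K, starlikeness makes x ↦ k(tK(x)) a self-map of the disc fixing 0, so
the Schwarz lemma bounds it by |x|. Differentiating at t = 1, where equality holds, gives Re zK'/K ≥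
0, and the minimum principle makes this strict. -/
theorem re_pos_of_starlike {K : ℂ → ℂ} (hS : K ∈ Starlike) {z : ℂ}
    (hz : z ∈ Metric.ball (0 : ℂ) 1) (hz0 : z ≠ 0) : 0 < (z * deriv K z / K z).re := by
  obtain ⟨hK, hinj, hstar⟩ := hS
  rw [starConvex_zero_iff] at hstar
  have h00 := hK.2.1
  have hb0 : (0 : ℂ) ∈ Metric.ball (0 : ℂ) 1 := Metric.mem_ball_self one_pos
  have hKne : ∀ z ∈ Metric.ball (0 : ℂ) 1, z ≠ 0 → K z ≠ 0 := fun z hz hz0 h =>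
    hz0 (hinj hz hb0 (h.trans h00.symm))
  set k := Function.invFunOn K (Metric.ball 0 1) with hk
  have hkmem : ∀ w ∈ K '' Metric.ball 0 1, k w ∈ Metric.ball (0 : ℂ) 1 := fun w hw =>
    Function.invFunOn_mem hw
  have hKk : ∀ w ∈ K '' Metric.ball 0 1, K (k w) = w := fun w hw => Function.invFunOn_eq hw
  have hkK : ∀ x ∈ Metric.ball (0 : ℂ) 1, k (K x) = x := fun x hx =>
    hinj.leftInvOn_invFunOn hx
  have hopen : IsOpen (K '' Metric.ball 0 1) :=
    isOpen_image_of_injOn hK.1 hinj Subset.rfl Metric.isOpen_ball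
  have hkd : ∀ x ∈ Metric.ball (0 : ℂ) 1, HasDerivAt k (deriv K x)⁻¹ (K x) := fun x hx => by
    refine HasDerivAt.of_local_left_inverse (f := K) ?_ ?_
      (deriv_ne_zero_of_injOn Metric.isOpen_ball hK.1 hinj hx) ?_
    · rw [ContinuousAt, hkK x hx]
      intro V hV
      obtain ⟨W, hWV, hWo, hxW⟩ := mem_nhds_iff.1
        (inter_mem hV (Metric.isOpen_ball.mem_nhds hx))
      have : K '' W ∈ 𝓝 (K x) := (isOpen_image_of_injOn hK.1 hinj
        (hWV.trans inter_subset_right) hWo).mem_nhds ⟨x, hxW, rfl⟩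
      refine mem_map.2 (mem_of_superset this ?_)
      rintro _ ⟨y, hy, rfl⟩
      rw [mem_preimage, hkK y (hWV hy).2]
      exact (hWV hy).1
    · rw [hkK x hx]
      exact (hK.1.differentiableAt (Metric.isOpen_ball.mem_nhds hx)).hasDerivAt
    · filter_upwards [hopen.mem_nhds ⟨x, hx, rfl⟩] with y hy using hKk y hy
  have hle : ∀ t ∈ Icc (0 : ℝ) 1, ∀ x ∈ Metric.ball (0 : ℂ) 1, ‖k (t * K x)‖ ≤ ‖x‖ := by
    intro t ht x hx
    have him : ∀ y ∈ Metric.ball (0 : ℂ) 1, (t : ℂ) * K y ∈ K '' Metric.ball 0 1 :=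
      fun y hy => by simpa using hstar (mem_image_of_mem K hy) ht.1 ht.2
    refine Complex.norm_le_norm_of_mapsTo_ball (f := fun x => k (t * K x)) (R := 1) ?_ ?_ ?_
      (mem_ball_zero_iff.1 hx)
    · intro y hy
      obtain ⟨u, hu, huy⟩ := him y hy
      have h1 := (hkd u hu).differentiableAt
      rw [huy] at h1
      exact (h1.comp y ((hK.1.differentiableAt
        (Metric.isOpen_ball.mem_nhds hy)).const_mul (t : ℂ))).differentiableWithinAt
    · exact fun y hy => Metric.ball_subset_closedBall (hkmem _ (him y hy))
    · have := hkK 0 hb0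
      rw [h00] at this
      simpa [h00] using this
  have hnn : ∀ x ∈ Metric.ball (0 : ℂ) 1, x ≠ 0 → 0 ≤ (x * deriv K x / K x).re := by
    intro x hx hx0
    have hw : HasDerivAt (fun t : ℝ => k (t * K x)) ((deriv K x)⁻¹ * K x) 1 := by
      have h1 : HasDerivAt (fun t : ℂ => t * K x) (K x) ((1 : ℝ) : ℂ) := by
        simpa using (hasDerivAt_id ((1 : ℝ) : ℂ)).mul_const (K x)
      have h2 := hkd x hx
      have h3 : HasDerivAt k (deriv K x)⁻¹ (((1 : ℝ) : ℂ) * K x) := by simpa using h2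
      exact (h3.comp ((1 : ℝ) : ℂ) h1).comp_ofReal
    have hN : HasDerivAt (fun t : ℝ => ((starRingEnd ℂ) x * k (t * K x)).re)
        ((starRingEnd ℂ) x * ((deriv K x)⁻¹ * K x)).re 1 :=
      Complex.reCLM.hasFDerivAt.comp_hasDerivAt (1 : ℝ) (hw.const_mul ((starRingEnd ℂ) x))
    -- For t < 1 the function is at most |x|², its value at t = 1, so its left difference quotients
    -- there are nonnegative.
    have hslope : 0 ≤ ((starRingEnd ℂ) x * ((deriv K x)⁻¹ * K x)).re := by
      have h1 := (hasDerivAt_iff_tendsto_slope.1 hN).mono_left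
        (nhdsWithin_mono (1 : ℝ) (s := Iio 1) (fun t (ht : t < 1) => ht.ne))
      refine ge_of_tendsto h1 ?_
      have h0 : ∀ᶠ t : ℝ in 𝓝[<] 1, 0 < t :=
        (lt_mem_nhds zero_lt_one).filter_mono nhdsWithin_le_nhds
      filter_upwards [h0, self_mem_nhdsWithin] with t ht ht1
      have ht1' : t < 1 := ht1
      rw [slope_def_field]
      refine div_nonneg_of_nonpos ?_ (by linarith)
      have h2 : ((starRingEnd ℂ) x * k (t * K x)).re ≤ ‖x‖ * ‖x‖ := by
        refine (Complex.re_le_norm _).trans ?_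
        rw [norm_mul, Complex.norm_conj]
        gcongr
        exact hle t ⟨ht.le, ht1'.le⟩ x hx
      have h3 : ((starRingEnd ℂ) x * k (((1 : ℝ) : ℂ) * K x)).re = ‖x‖ * ‖x‖ := by
        rw [Complex.ofReal_one, one_mul, hkK x hx, mul_comm, Complex.mul_conj,
          Complex.ofReal_re, Complex.normSq_eq_norm_sq]
        ring
      linarith
    have hd0 := deriv_ne_zero_of_injOn Metric.isOpen_ball hK.1 hinj hx
    have hK0 := hKne x hx hx0
    -- The derivative is |x|² times the reciprocal of xK'/K, and inversion preserves the sign of the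
    -- real part.
    have h4 : (starRingEnd ℂ) x * ((deriv K x)⁻¹ * K x) =
        Complex.normSq x * (x * deriv K x / K x)⁻¹ := by
      rw [← Complex.mul_conj]
      field_simp
    rw [h4, Complex.re_ofReal_mul, Complex.inv_re] at hslope
    have h5 : 0 < Complex.normSq x := Complex.normSq_pos.2 hx0
    have h6 : 0 < Complex.normSq (x * deriv K x / K x) :=
      Complex.normSq_pos.2 (div_ne_zero (mul_ne_zero hx0 hd0) hK0)
    rw [mul_nonneg_iff_of_pos_left h5, le_div_iff₀ h6, zero_mul] at hslope
    exact hslope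
  have hball : Metric.ball (0 : ℂ) 1 ∈ 𝓝 (0 : ℂ) := Metric.ball_mem_nhds _ one_pos
  have hD := (Complex.differentiableOn_dslope hball).2 hK.1
  have hDne : ∀ x ∈ Metric.ball (0 : ℂ) 1, dslope K 0 x ≠ 0 := fun x hx => by
    rcases eq_or_ne x 0 with rfl | hx0
    · simp [hK.2.2]
    · have := hKne x hx hx0
      rw [eq_mul_dslope h00] at this
      exact right_ne_zero_of_mul this
  have hq : ∀ x, x ≠ 0 → deriv K x / dslope K 0 x = x * deriv K x / K x := fun x hx => by
    rw [eq_mul_dslope h00 x]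
    field_simp
  rw [← hq z hz0]
  refine re_lt_of_re_le (G := fun x => deriv K x / dslope K 0 x)
    ((hK.1.deriv Metric.isOpen_ball).div hD hDne) (fun x hx => ?_) ?_ z hz
  · rcases eq_or_ne x 0 with rfl | hx0
    · simp [hK.2.2]
    · rw [hq x hx0]
      exact hnn x hx hx0
  · simp [hK.2.2]

theorem starlike_iff {K : ℂ → ℂ} (hK : K ∈ ClassA) :
    K ∈ Starlike ↔ ∀ z ∈ Metric.ball (0 : ℂ) 1, z ≠ 0 → 0 < (z * deriv K z / K z).re :=
  ⟨fun h _ hz hz0 => re_pos_of_starlike h hz hz0, starlike_of_re_pos hK⟩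

/-! ### The Pascu class in terms of K -/

theorem pascuComb_hasDerivAt {ξ : ℝ} {F : ℂ → ℂ} (hF : DifferentiableOn ℂ F (Metric.ball 0 1))
    {z : ℂ} (hz : z ∈ Metric.ball (0 : ℂ) 1) :
    HasDerivAt (pascuComb ξ F)
      ((ξ : ℂ) * deriv (fun w => w * deriv F w) z + (1 - (ξ : ℂ)) * deriv F z) z := by
  have hn := Metric.isOpen_ball.mem_nhds hz
  have h1 := (hF.differentiableAt hn).hasDerivAt
  have h2 : DifferentiableAt ℂ (fun w => w * deriv F w) z :=
    differentiableAt_id.mul ((hF.deriv Metric.isOpen_ball).differentiableAt hn)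
  exact (h2.hasDerivAt.const_mul _).add (h1.const_mul _)

theorem pascuComb_mem_classA {ξ : ℝ} {F : ℂ → ℂ} (hF : F ∈ ClassA) :
    pascuComb ξ F ∈ ClassA := by
  obtain ⟨hd, h0, h1⟩ := hF
  refine ⟨fun z hz => (pascuComb_hasDerivAt hd hz).differentiableAt.differentiableWithinAt,
    by simp [pascuComb, h0], ?_⟩
  have hb0 : (0 : ℂ) ∈ Metric.ball (0 : ℂ) 1 := Metric.mem_ball_self one_pos
  have hn := Metric.isOpen_ball.mem_nhds hb0
  rw [(pascuComb_hasDerivAt hd hb0).deriv]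
  have h2 : HasDerivAt (fun w => w * deriv F w) (1 * deriv F 0 + 0 * deriv (deriv F) 0) 0 :=
    (hasDerivAt_id (0 : ℂ)).mul
      ((hd.deriv Metric.isOpen_ball).differentiableAt hn).hasDerivAt
  rw [h2.deriv, h1]
  ring

/-- The numerator of the Pascu quotient is z times the derivative of its denominator. -/
theorem mem_classM_iff {ξ : ℝ} {F : ℂ → ℂ} (hF : F ∈ ClassA) :
    F ∈ ClassM ξ ↔ ∀ z ∈ Metric.ball (0 : ℂ) 1, z ≠ 0 →
      0 < (z * deriv (pascuComb ξ F) z / pascuComb ξ F z).re := by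
  refine ⟨fun h z hz hz0 => ?_, fun h => ⟨hF, fun z hz hz0 => ?_⟩⟩
  · convert! h.2 z hz hz0 using 3
    rw [(pascuComb_hasDerivAt hF.1 hz).deriv]
    ring
  · convert! h z hz hz0 using 3
    rw [(pascuComb_hasDerivAt hF.1 hz).deriv]
    ring

/-! ### The weight t^(1/μ-1)Π(t): Fubini, moments and the value of β -/

/-- Exchange of the order of integration over the triangle `0 < t < x ≤ 1`. -/
theorem integral_tail_mul {κ ψ : ℝ → ℝ}
    (hκ : AEStronglyMeasurable κ (volume.restrict (Ioc 0 1)))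
    (hψ : IntegrableOn ψ (Ioc 0 1))
    (hint : IntegrableOn (fun x => |κ x| * ∫ t in (0 : ℝ)..x, |ψ t|) (Ioc 0 1)) :
    IntegrableOn (fun t => (∫ x in t..1, κ x) * ψ t) (Ioc 0 1) ∧
      ∫ t in (0 : ℝ)..1, (∫ x in t..1, κ x) * ψ t =
        ∫ x in (0 : ℝ)..1, κ x * ∫ t in (0 : ℝ)..x, ψ t := by
  set m := volume.restrict (Ioc (0 : ℝ) 1) with hm
  set T : Set (ℝ × ℝ) := {p | p.2 < p.1}
  have hT : MeasurableSet T := measurableSet_lt measurable_snd measurable_fst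
  set F : ℝ × ℝ → ℝ := T.indicator fun p => κ p.1 * ψ p.2
  have hFx : ∀ x t, F (x, t) = κ x * (Iio x).indicator ψ t := fun x t => by
    by_cases h : t < x
    · simp [F, T, indicator, h]
    · simp [F, T, indicator, h]
  have hFt : ∀ x t, F (x, t) = (Ioi t).indicator κ x * ψ t := fun x t => by
    by_cases h : t < x
    · simp [F, T, indicator, h]
    · simp [F, T, indicator, h]
  have hsec : ∀ (ρ : ℝ → ℝ), ∀ x ∈ Ioc (0 : ℝ) 1,
      ∫ t, (Iio x).indicator ρ t ∂m = ∫ t in (0 : ℝ)..x, ρ t := fun ρ x hx => by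
    rw [integral_indicator measurableSet_Iio, hm, Measure.restrict_restrict measurableSet_Iio,
      show Iio x ∩ Ioc 0 1 = Ioo 0 x by
        ext t
        simp only [mem_inter_iff, mem_Iio, mem_Ioc, mem_Ioo]
        exact ⟨fun h => ⟨h.2.1, h.1⟩, fun h => ⟨h.2, h.1, h.2.le.trans hx.2⟩⟩,
      intervalIntegral.integral_of_le hx.1.le, integral_Ioc_eq_integral_Ioo]
  have hsec' : ∀ t ∈ Ioc (0 : ℝ) 1, ∫ x, (Ioi t).indicator κ x ∂m = ∫ x in t..1, κ x :=
    fun t ht => by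
    rw [integral_indicator measurableSet_Ioi, hm, Measure.restrict_restrict measurableSet_Ioi,
      show Ioi t ∩ Ioc 0 1 = Ioc t 1 by
        ext x
        simp only [mem_inter_iff, mem_Ioi, mem_Ioc]
        exact ⟨fun h => ⟨h.1, h.2.2⟩, fun h => ⟨h.1, ht.1.trans h.1, h.2⟩⟩,
      intervalIntegral.integral_of_le ht.2]
  have hFm : AEStronglyMeasurable F (m.prod m) :=
    (hκ.comp_fst.mul hψ.aestronglyMeasurable.comp_snd).indicator hT
  have hFi : Integrable F (m.prod m) := by
    rw [integrable_prod_iff hFm]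
    constructor
    · refine Eventually.of_forall fun x => ?_
      simp only [hFx]
      exact (hψ.indicator measurableSet_Iio).const_mul _
    · refine hint.congr ?_
      filter_upwards [ae_restrict_mem measurableSet_Ioc] with x hx
      rw [← hsec _ x hx, ← integral_const_mul]
      refine integral_congr_ae (Eventually.of_forall fun t => ?_)
      simp only [hFx, norm_mul, Real.norm_eq_abs]
      by_cases h : t ∈ Iio x <;> simp [h]
  have e1 : ∀ t ∈ Ioc (0 : ℝ) 1, ∫ x, F (x, t) ∂m = (∫ x in t..1, κ x) * ψ t := fun t ht => by
    simp only [hFt]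
    rw [integral_mul_const, hsec' t ht]
  have e2 : ∀ x ∈ Ioc (0 : ℝ) 1, ∫ t, F (x, t) ∂m = κ x * ∫ t in (0 : ℝ)..x, ψ t := fun x hx => by
    simp only [hFx]
    rw [integral_const_mul, hsec ψ x hx]
  constructor
  · refine hFi.integral_prod_right.congr ?_
    filter_upwards [ae_restrict_mem measurableSet_Ioc] with t ht using e1 t ht
  · rw [intervalIntegral.integral_of_le zero_le_one, intervalIntegral.integral_of_le zero_le_one,
      ← setIntegral_congr_fun measurableSet_Ioc e1, ← setIntegral_congr_fun measurableSet_Ioc e2]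
    exact (integral_integral_swap (f := fun x t => F (x, t)) hFi).symm

theorem rpow_mul_integrableOn {a : ℝ} (ha : 0 < a) {φ : ℝ → ℝ} (hφ : Continuous φ) :
    IntegrableOn (fun t : ℝ => t ^ (a - 1) * φ t) (Ioc 0 1) := by
  have h : IntervalIntegrable (fun t : ℝ => t ^ (a - 1) * φ t) volume 0 1 :=
    (intervalIntegral.intervalIntegrable_rpow' (by linarith)).mul_continuousOn hφ.continuousOn
  exact h.1

theorem integrableOn_mul_of_bounded {u φ : ℝ → ℝ} {M : ℝ} (hu : IntegrableOn u (Ioc 0 1))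
    (hφ : Continuous φ) (hM : ∀ y, |φ y| ≤ M) : IntegrableOn (fun t => u t * φ t) (Ioc 0 1) :=
  Integrable.mul_bdd (c := M) hu hφ.aestronglyMeasurable (Eventually.of_forall hM)

/-- Fubini over the triangle; the inner integral of t^(a-1)φ(t) over [0,x] is x^a `avg a φ x` by
scaling. Assuming integrability only of x^a κ admits kernels singular at 0. -/
theorem integral_rpow_mul_tail {a M : ℝ} (ha : 0 < a) {κ φ : ℝ → ℝ}
    (hκ : IntegrableOn (fun x => x ^ a * κ x) (Ioc 0 1)) (hφ : Continuous φ)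
    (hM : ∀ y, |φ y| ≤ M) :
    IntegrableOn (fun t => t ^ (a - 1) * (∫ x in t..1, κ x) * φ t) (Ioc 0 1) ∧
      ∫ t in (0 : ℝ)..1, t ^ (a - 1) * (∫ x in t..1, κ x) * φ t =
        ∫ x in (0 : ℝ)..1, x ^ a * κ x * avg a φ x := by
  -- Measurability of κ itself is recovered by dividing out the positive factor x^a.
  have hκm : AEStronglyMeasurable κ (volume.restrict (Ioc 0 1)) := by
    have h1 : AEStronglyMeasurable (fun x : ℝ => x ^ (-a) * (x ^ a * κ x))
        (volume.restrict (Ioc 0 1)) :=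
      (Measurable.aestronglyMeasurable (by fun_prop)).mul hκ.aestronglyMeasurable
    refine h1.congr ?_
    filter_upwards [ae_restrict_mem measurableSet_Ioc] with x hx
    rw [← mul_assoc, ← Real.rpow_add hx.1, neg_add_cancel, Real.rpow_zero, one_mul]
  have hψ := rpow_mul_integrableOn ha hφ
  have hint : IntegrableOn (fun x => |κ x| * ∫ t in (0 : ℝ)..x, |t ^ (a - 1) * φ t|)
      (Ioc 0 1) := by
    have h1 := integrableOn_mul_of_bounded hκ.abs
      (avg_bound_continuous ha hφ.abs (M := M) (fun y => by simpa using hM y))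
      (avg_bounded ha (M := M) (fun y => by simpa using hM y))
    refine h1.congr_fun (fun x hx => ?_) measurableSet_Ioc
    have h2 : ∫ t in (0 : ℝ)..x, |t ^ (a - 1) * φ t| =
        ∫ t in (0 : ℝ)..x, t ^ (a - 1) * |φ t| := by
      refine intervalIntegral.integral_congr fun t ht => ?_
      rw [uIcc_of_le hx.1.le] at ht
      simp only [abs_mul, abs_of_nonneg (Real.rpow_nonneg ht.1 (a - 1))]
    have h3 : x ^ a * avg a (fun y => |φ y|) x = ∫ t in (0 : ℝ)..x, t ^ (a - 1) * |φ t| :=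
      avg_eq hx.1
    show |x ^ a * κ x| * avg a (fun y => |φ y|) x = |κ x| * ∫ t in (0 : ℝ)..x, |t ^ (a - 1) * φ t|
    rw [h2, ← h3, abs_mul, abs_of_nonneg (Real.rpow_nonneg hx.1.le a)]
    ring
  obtain ⟨h1, h2⟩ := integral_tail_mul hκm hψ hint
  have e : ∀ t : ℝ, (∫ x in t..1, κ x) * (t ^ (a - 1) * φ t) =
      t ^ (a - 1) * (∫ x in t..1, κ x) * φ t := fun t => by ring
  simp only [e] at h1 h2
  refine ⟨h1, h2.trans ?_⟩
  rw [intervalIntegral.integral_of_le zero_le_one, intervalIntegral.integral_of_le zero_le_one]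
  refine setIntegral_congr_fun measurableSet_Ioc fun x hx => ?_
  simp only [← avg_eq hx.1]
  ring

section Weight

variable {lam : ℝ → ℝ} {μ ν : ℝ}

theorem integral_lam_tail (hν : 0 < ν) (hlam : IntegrableOn lam (Ioc 0 1)) {φ : ℝ → ℝ} {M : ℝ}
    (hφ : Continuous φ) (hM : ∀ y, |φ y| ≤ M) :
    IntegrableOn (fun t => t ^ (1 / ν - 1) * Lam lam ν t * φ t) (Ioc 0 1) ∧
      ∫ t in (0 : ℝ)..1, t ^ (1 / ν - 1) * Lam lam ν t * φ t =
        ∫ t in (0 : ℝ)..1, lam t * avg (1 / ν) φ t := by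
  have e : ∀ x ∈ Ioc (0 : ℝ) 1, x ^ (1 / ν) * (lam x / x ^ (1 / ν)) = lam x := fun x hx => by
    have := Real.rpow_pos_of_pos hx.1 (1 / ν)
    field_simp
  have h := integral_rpow_mul_tail (κ := fun x => lam x / x ^ (1 / ν)) (a := 1 / ν)
    (by positivity) (hlam.congr_fun (fun x hx => (e x hx).symm) measurableSet_Ioc) hφ hM
  refine ⟨h.1, h.2.trans ?_⟩
  rw [intervalIntegral.integral_of_le zero_le_one, intervalIntegral.integral_of_le zero_le_one]
  refine setIntegral_congr_fun measurableSet_Ioc fun x hx => ?_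
  simp only [e x hx]

/-- Π is an iterated tail integral of λ, so two exchanges of order move both tails onto φ as two
averages. The powers of x in Λ and Π are those that cancel in the process. -/
theorem integral_piFun (hμ : 0 < μ) (hν : 0 < ν) (hlam : IntegrableOn lam (Ioc 0 1))
    {φ : ℝ → ℝ} {M : ℝ} (hφ : Continuous φ) (hM : ∀ y, |φ y| ≤ M) :
    IntegrableOn (fun t => t ^ (1 / μ - 1) * PiFun lam μ ν t * φ t) (Ioc 0 1) ∧
      ∫ t in (0 : ℝ)..1, t ^ (1 / μ - 1) * PiFun lam μ ν t * φ t =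
        ∫ t in (0 : ℝ)..1, lam t * avg (1 / ν) (avg (1 / μ) φ) t := by
  have hb : 0 < 1 / μ := by positivity
  have e : ∀ x ∈ Ioc (0 : ℝ) 1, x ^ (1 / μ) * (Lam lam ν x * x ^ (1 / ν - 1 - 1 / μ)) =
      x ^ (1 / ν - 1) * Lam lam ν x := fun x hx => by
    rw [mul_left_comm, ← Real.rpow_add hx.1, mul_comm]
    ring_nf
  have h1 := (integral_lam_tail hν hlam (φ := fun _ => 1) (M := 1) continuous_const
    (by simp)).1
  simp only [mul_one] at h1
  have h := integral_rpow_mul_tail (κ := fun x => Lam lam ν x * x ^ (1 / ν - 1 - 1 / μ))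
    (a := 1 / μ) hb (h1.congr_fun (fun x hx => (e x hx).symm) measurableSet_Ioc) hφ hM
  refine ⟨h.1, h.2.trans ?_⟩
  rw [← (integral_lam_tail hν hlam (avg_bound_continuous hb hφ hM) (avg_bounded hb hM)).2,
    intervalIntegral.integral_of_le zero_le_one, intervalIntegral.integral_of_le zero_le_one]
  refine setIntegral_congr_fun measurableSet_Ioc fun x hx => ?_
  simp only [e x hx]

theorem avg_congr {a : ℝ} {φ χ : ℝ → ℝ} (h : EqOn φ χ (Icc 0 1)) :
    EqOn (avg a φ) (avg a χ) (Icc 0 1) := by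
  intro x hx
  refine intervalIntegral.integral_congr fun s hs => ?_
  rw [uIcc_of_le zero_le_one] at hs
  simp only [h ⟨mul_nonneg hs.1 hx.1, mul_le_one₀ hs.2 hx.1 hx.2⟩]

/-- Monomials are eigenfunctions of the averaging operator. Its two uses, with 1/μ and 1/ν, produce
the factor μν/((1+μn)(1+νn)) of the moments. -/
theorem avg_const_mul_pow {a : ℝ} (ha : 0 < a) (c : ℝ) (n : ℕ) :
    EqOn (avg a fun x => c * x ^ n) (fun x => c / (a + n) * x ^ n) (Icc 0 1) := by
  intro x _
  have hn : (0 : ℝ) ≤ n := n.cast_nonneg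
  have h1 : avg a (fun x => c * x ^ n) x =
      ∫ s in (0 : ℝ)..1, s ^ (a - 1 + n) * (c * x ^ n) := by
    unfold avg
    rw [intervalIntegral.integral_of_le zero_le_one, intervalIntegral.integral_of_le zero_le_one]
    refine setIntegral_congr_fun measurableSet_Ioc fun s hs => ?_
    simp only [Real.rpow_add hs.1, Real.rpow_natCast]
    ring
  rw [h1, intervalIntegral.integral_mul_const, integral_rpow (Or.inl (by linarith)),
    Real.one_rpow, Real.zero_rpow (by linarith), show a - 1 + n + 1 = a + n by ring]
  have : a + n ≠ 0 := by positivity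
  field_simp
  ring

/-- The moments of the weight `t^(1/μ-1) Π(t)`. -/
theorem moment_piFun (hμ : 0 < μ) (hν : 0 < ν) (hlam : IntegrableOn lam (Ioc 0 1)) (n : ℕ) :
    ∫ t in (0 : ℝ)..1, t ^ (1 / μ - 1) * PiFun lam μ ν t * t ^ n =
      μ * ν / ((1 + μ * n) * (1 + ν * n)) * ∫ t in (0 : ℝ)..1, lam t * t ^ n := by
  -- Clamping to [0,1] makes the monomial bounded on the whole line without changing the values that
  -- are integrated.
  set φ : ℝ → ℝ := fun y => (max 0 (min y 1)) ^ n with hφd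
  have hφ : Continuous φ := by fun_prop
  have hM : ∀ y, |φ y| ≤ 1 := fun y => by
    rw [hφd, abs_of_nonneg (by positivity)]
    exact pow_le_one₀ (le_max_left _ _) (max_le zero_le_one (min_le_right _ _))
  have hφe : EqOn φ (fun x => 1 * x ^ n) (Icc 0 1) := fun x hx => by
    simp [hφd, min_eq_left hx.2, max_eq_right hx.1]
  have ha : 0 < 1 / ν := by positivity
  have hb : 0 < 1 / μ := by positivity
  have h1 := (avg_congr hφe (a := 1 / μ)).trans (avg_const_mul_pow hb 1 n)
  have h2 := (avg_congr h1 (a := 1 / ν)).trans (avg_const_mul_pow ha _ n)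
  have h3 := (integral_piFun hμ hν hlam hφ hM).2
  rw [← intervalIntegral.integral_const_mul]
  trans ∫ t in (0 : ℝ)..1, t ^ (1 / μ - 1) * PiFun lam μ ν t * φ t
  · refine intervalIntegral.integral_congr fun t ht => ?_
    rw [uIcc_of_le zero_le_one] at ht
    simp only [hφe ht, one_mul]
  · rw [h3]
    refine intervalIntegral.integral_congr fun t ht => ?_
    rw [uIcc_of_le zero_le_one] at ht
    simp only [h2 ht]
    field_simp

/-- The function compared with `Re h'` and `Re h(z)/z` in `N_Π`. -/
noncomputable def koebeMin (ξ t : ℝ) : ℝ := (1 - ξ) / (1 + |t|) ^ 2 + ξ * ((1 - |t|) / (1 + |t|) ^ 3)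

theorem continuous_inv_sq : Continuous fun y : ℝ => 1 / (1 + |y|) ^ 2 := by
  refine continuous_const.div (by fun_prop) fun y => ?_
  positivity

theorem abs_inv_sq_le (y : ℝ) : |1 / (1 + |y|) ^ 2| ≤ 1 := by
  rw [abs_of_nonneg (by positivity), div_le_one (by positivity)]
  nlinarith [abs_nonneg y]

theorem continuous_koebe_deriv : Continuous fun y : ℝ => (1 - |y|) / (1 + |y|) ^ 3 := by
  refine Continuous.div (by fun_prop) (by fun_prop) fun y => ?_
  positivity

theorem abs_koebe_deriv_le (y : ℝ) : |(1 - |y|) / (1 + |y|) ^ 3| ≤ 1 := by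
  have h0 := abs_nonneg y
  have h1 : 0 < (1 + |y|) ^ 3 := by positivity
  have h2 : 1 + |y| ≤ (1 + |y|) ^ 3 := le_self_pow₀ (by linarith) (by norm_num)
  rw [abs_div, abs_of_pos h1, div_le_one h1]
  refine le_trans ?_ h2
  rw [abs_le]
  constructor <;> linarith

/-- The double average solves the same differential equation and is continuous, so uniqueness
identifies it with `1 + g`. -/
theorem solG_eq (hμ : 0 < μ) (hν : 0 < ν) {g : ℝ → ℝ} (hg : IsSolG μ ν g) {t : ℝ}
    (ht : t ∈ Ioc (0 : ℝ) 1) :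
    1 + g t = 2 / (μ * ν) * avg (1 / ν) (avg (1 / μ) fun y => 1 / (1 + |y|) ^ 2) t := by
  have ha : 0 < 1 / ν := by positivity
  have hb : 0 < 1 / μ := by positivity
  have hc := avg_bound_continuous hb continuous_inv_sq abs_inv_sq_le
  have hc2 := avg_bound_continuous ha hc (avg_bounded hb abs_inv_sq_le)
  refine eqOn_of_hasDerivAt (u := fun t => 1 + g t)
    (v := fun t => 2 / (μ * ν) * avg (1 / ν) (avg (1 / μ) fun y => 1 / (1 + |y|) ^ 2) t) ha
    (continuousOn_const.add hg.cont) (continuous_const.mul hc2).continuousOn hg.ode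
    (fun t ht => ?_) ht
  have h := (avg_hasDerivAt ha hc ht.1).const_mul (2 / (μ * ν))
  have e : avg (1 / μ) (fun y => 1 / (1 + |y|) ^ 2) t =
      ∫ s in (0 : ℝ)..1, s ^ (1 / μ - 1) / (1 + s * t) ^ 2 := by
    refine intervalIntegral.integral_congr fun s hs => ?_
    rw [uIcc_of_le zero_le_one] at hs
    simp only [abs_of_nonneg (mul_nonneg hs.1 ht.1.le)]
    ring
  rw [e, ← mul_assoc] at h
  refine h.congr_of_eventuallyEq (Eventually.of_forall fun y => ?_)
  ring

theorem solQ_eq (hμ : 0 < μ) (hν : 0 < ν) {q : ℝ → ℝ} (hq : IsSolQ μ ν q) {t : ℝ}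
    (ht : t ∈ Ioc (0 : ℝ) 1) :
    q t = 1 / (μ * ν) *
      avg (1 / ν) (avg (1 / μ) fun y => (1 - |y|) / (1 + |y|) ^ 3) t := by
  have ha : 0 < 1 / ν := by positivity
  have hb : 0 < 1 / μ := by positivity
  have hc := avg_bound_continuous hb continuous_koebe_deriv abs_koebe_deriv_le
  have hc2 := avg_bound_continuous ha hc (avg_bounded hb abs_koebe_deriv_le)
  refine eqOn_of_hasDerivAt (v := fun t => 1 / (μ * ν) *
      avg (1 / ν) (avg (1 / μ) fun y => (1 - |y|) / (1 + |y|) ^ 3) t) ha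
    hq.cont (continuous_const.mul hc2).continuousOn hq.ode (fun t ht => ?_) ht
  have h := (avg_hasDerivAt ha hc ht.1).const_mul (1 / (μ * ν))
  have e : avg (1 / μ) (fun y => (1 - |y|) / (1 + |y|) ^ 3) t =
      ∫ s in (0 : ℝ)..1, s ^ (1 / μ - 1) * ((1 - s * t) / (1 + s * t) ^ 3) := by
    refine intervalIntegral.integral_congr fun s hs => ?_
    rw [uIcc_of_le zero_le_one] at hs
    simp only [abs_of_nonneg (mul_nonneg hs.1 ht.1.le)]
  rw [e, ← mul_assoc] at h
  refine h.congr_of_eventuallyEq (Eventually.of_forall fun y => ?_)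
  ring

/-- The value of `β` in terms of the weight `t^(1/μ-1) Π(t)`. -/
theorem integral_koebeMin (hμ : 0 < μ) (hν : 0 < ν) (hlam : IntegrableOn lam (Ioc 0 1))
    (hlam1 : ∫ t in (0 : ℝ)..1, lam t = 1) {g q : ℝ → ℝ} (hg : IsSolG μ ν g)
    (hq : IsSolQ μ ν q) {ξ β : ℝ} (hβ1 : β < 1)
    (hβ : β / (1 - β) = -∫ t in (0 : ℝ)..1, lam t * ((1 - ξ) * g t + ξ * (2 * q t - 1))) :
    ∫ t in (0 : ℝ)..1, t ^ (1 / μ - 1) * PiFun lam μ ν t * koebeMin ξ t =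
      μ * ν * (1 - 1 / (2 * (1 - β))) := by
  have ha : 0 < 1 / ν := by positivity
  have hb : 0 < 1 / μ := by positivity
  obtain ⟨i₁, e₁⟩ := integral_piFun hμ hν hlam continuous_inv_sq abs_inv_sq_le
  obtain ⟨i₂, e₂⟩ := integral_piFun hμ hν hlam continuous_koebe_deriv abs_koebe_deriv_le
  have j₁ := integrableOn_mul_of_bounded hlam
    (avg_bound_continuous ha (avg_bound_continuous hb continuous_inv_sq abs_inv_sq_le)
      (avg_bounded hb abs_inv_sq_le)) (avg_bounded ha (avg_bounded hb abs_inv_sq_le))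
  have j₂ := integrableOn_mul_of_bounded hlam
    (avg_bound_continuous ha (avg_bound_continuous hb continuous_koebe_deriv abs_koebe_deriv_le)
      (avg_bounded hb abs_koebe_deriv_le)) (avg_bounded ha (avg_bounded hb abs_koebe_deriv_le))
  have hL : ∫ t in (0 : ℝ)..1, t ^ (1 / μ - 1) * PiFun lam μ ν t * koebeMin ξ t =
      (1 - ξ) * (∫ t in (0 : ℝ)..1, t ^ (1 / μ - 1) * PiFun lam μ ν t * (1 / (1 + |t|) ^ 2)) +
      ξ * ∫ t in (0 : ℝ)..1, t ^ (1 / μ - 1) * PiFun lam μ ν t *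
        ((1 - |t|) / (1 + |t|) ^ 3) := by
    simp only [intervalIntegral.integral_of_le zero_le_one]
    rw [← integral_const_mul, ← integral_const_mul,
      ← integral_add (i₁.const_mul _) (i₂.const_mul _)]
    refine integral_congr_ae (Eventually.of_forall fun t => ?_)
    simp only [koebeMin]
    ring
  set A₁ := avg (1 / ν) (avg (1 / μ) fun y => 1 / (1 + |y|) ^ 2)
  set A₂ := avg (1 / ν) (avg (1 / μ) fun y => (1 - |y|) / (1 + |y|) ^ 3)
  have hR : ∫ t in (0 : ℝ)..1, lam t * ((1 - ξ) * g t + ξ * (2 * q t - 1)) =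
      2 / (μ * ν) * ((1 - ξ) * (∫ t in (0 : ℝ)..1, lam t * A₁ t) +
        ξ * ∫ t in (0 : ℝ)..1, lam t * A₂ t) - 1 := by
    -- The constant 1 is rewritten as the integral of λ, so that both sides can be compared under
    -- one integral.
    refine Eq.trans ?_ (congrArg (_ - ·) hlam1)
    have j₃ : IntegrableOn (fun t => 2 / (μ * ν) * ((1 - ξ) * (lam t * A₁ t) +
        ξ * (lam t * A₂ t))) (Ioc 0 1) := ((j₁.const_mul _).add (j₂.const_mul _)).const_mul _
    simp only [intervalIntegral.integral_of_le zero_le_one]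
    rw [← integral_const_mul, ← integral_const_mul,
      ← integral_add (j₁.const_mul _) (j₂.const_mul _), ← integral_const_mul,
      ← integral_sub j₃ hlam]
    refine setIntegral_congr_fun measurableSet_Ioc fun t ht => ?_
    have hgt : g t = 2 / (μ * ν) * A₁ t - 1 := by linarith [solG_eq hμ hν hg ht]
    simp only [hgt, solQ_eq hμ hν hq ht]
    ring
  rw [hL, e₁, e₂]
  rw [hR] at hβ
  set X := (1 - ξ) * (∫ t in (0 : ℝ)..1, lam t * A₁ t) + ξ * ∫ t in (0 : ℝ)..1, lam t * A₂ t
  have h1 : 1 - β ≠ 0 := by linarith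
  have hμν : μ * ν ≠ 0 := by positivity
  field_simp at hβ ⊢
  linear_combination hβ

end Weight

/-! ### Hadamard products and positive real part -/

/-- `e^{inθ}`. -/
noncomputable def expInt (n : ℤ) (θ : ℝ) : ℂ := Complex.exp (n * θ * Complex.I)

theorem continuous_expInt (n : ℤ) : Continuous (expInt n) := by
  unfold expInt
  fun_prop

theorem expInt_mul (n m : ℤ) (θ : ℝ) : expInt n θ * expInt m θ = expInt (n + m) θ := by
  rw [expInt, expInt, expInt, ← Complex.exp_add]
  push_cast
  ring_nf

theorem norm_expInt (n : ℤ) (θ : ℝ) : ‖expInt n θ‖ = 1 := by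
  rw [expInt, show (n : ℂ) * θ * Complex.I = ((n * θ : ℝ) : ℂ) * Complex.I by push_cast; ring,
    Complex.norm_exp_ofReal_mul_I]

theorem expInt_pow (n : ℤ) (θ : ℝ) (k : ℕ) : expInt n θ ^ k = expInt (k * n) θ := by
  rw [expInt, expInt, ← Complex.exp_nat_mul]
  push_cast
  ring_nf

theorem conj_expInt (n : ℤ) (θ : ℝ) : (starRingEnd ℂ) (expInt n θ) = expInt (-n) θ := by
  rw [expInt, expInt, ← Complex.exp_conj]
  simp

theorem expInt_zero (θ : ℝ) : expInt 0 θ = 1 := by simp [expInt]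

theorem integral_expInt (n : ℤ) :
    ∫ θ in (0 : ℝ)..2 * Real.pi, expInt n θ = if n = 0 then 2 * (Real.pi : ℂ) else 0 := by
  split_ifs with h
  · simp [h, expInt_zero]
  · have hc : (n : ℂ) * Complex.I ≠ 0 := mul_ne_zero (Int.cast_ne_zero.2 h) Complex.I_ne_zero
    have e : ∀ θ : ℝ, expInt n θ = Complex.exp ((n : ℂ) * Complex.I * θ) := fun θ => by
      rw [expInt]
      ring_nf
    simp only [e]
    rw [integral_exp_mul_complex hc]
    have h2 : Complex.exp ((n : ℂ) * Complex.I * ((2 * Real.pi : ℝ) : ℂ)) = 1 := by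
      rw [Complex.exp_eq_one_iff]
      exact ⟨n, by push_cast; ring⟩
    rw [h2]
    simp

theorem hasSum_integral_mul {x : ℕ → ℂ} {u : ℕ → ℝ → ℂ} {S H : ℝ → ℂ}
    (hx : Summable fun k => ‖x k‖) (hu : ∀ k, Continuous (u k)) (hu1 : ∀ k θ, ‖u k θ‖ = 1)
    (hS : ∀ θ, HasSum (fun k => x k * u k θ) (S θ)) (hH : Continuous H) (a b : ℝ) :
    HasSum (fun k => x k * ∫ θ in a..b, u k θ * H θ) (∫ θ in a..b, S θ * H θ) := by
  have h := intervalIntegral.hasSum_integral_of_dominated_convergence (μ := volume)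
    (a := a) (b := b) (F := fun k θ => x k * (u k θ * H θ))
    (f := fun θ => S θ * H θ) (fun k θ => ‖x k‖ * ‖H θ‖) ?_ ?_ ?_ ?_ ?_
  · simpa only [intervalIntegral.integral_const_mul] using h
  · exact fun k => (continuous_const.mul ((hu k).mul hH)).aestronglyMeasurable
  · refine fun k => Eventually.of_forall fun θ _ => ?_
    rw [norm_mul, norm_mul, hu1, one_mul]
  · exact Eventually.of_forall fun θ _ => hx.mul_right _
  · simp only [tsum_mul_right]
    exact (continuous_const.mul hH.norm).intervalIntegrable _ _
  · refine Eventually.of_forall fun θ _ => ?_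
    simpa only [mul_assoc] using (hS θ).mul_right (H θ)

/-- A convolution inequality: the Hadamard product of a function of positive real part with a
function whose real part exceeds `κ`. -/
theorem lt_re_of_hasSum_hadamard {q c : ℕ → ℂ} {Q Ψ : ℂ → ℂ} (hQ : HasPS q Q) (hΨ : HasPS c Ψ)
    (hc : c 0 = 1) {κ : ℝ} (hQpos : ∀ z ∈ Metric.ball (0 : ℂ) 1, 0 < (Q z).re)
    (hΨκ : ∀ z ∈ Metric.ball (0 : ℂ) 1, κ < (Ψ z).re)
    {z X : ℂ} (hz : z ∈ Metric.ball (0 : ℂ) 1) (hX : HasSum (fun m => q m * c m * z ^ m) X) :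
    (2 * κ - 1) * (q 0).re < X.re := by
  have hpi := Real.pi_pos
  obtain ⟨ρ, hzρ, hρ1⟩ := exists_between (mem_ball_zero_iff.1 hz)
  have hρ0 : 0 < ρ := (norm_nonneg z).trans_lt hzρ
  have hρC : (ρ : ℂ) ≠ 0 := Complex.ofReal_ne_zero.2 hρ0.ne'
  -- The radius is split as z = ρy with both factors inside the disc, so that each series converges
  -- absolutely on its own circle.
  set y := z / ρ with hy
  have hy1 : ‖y‖ < 1 := by
    rw [hy, norm_div, Complex.norm_real, Real.norm_of_nonneg hρ0.le, div_lt_one hρ0]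
    exact hzρ
  set G : ℝ → ℂ := fun θ => Ψ (y * expInt (-1) θ) with hG
  set P : ℝ → ℂ := fun θ => Q (ρ * expInt 1 θ) with hP
  have hGmem : ∀ θ, y * expInt (-1) θ ∈ Metric.ball (0 : ℂ) 1 := fun θ => by
    rw [mem_ball_zero_iff, norm_mul, norm_expInt, mul_one]
    exact hy1
  have hPmem : ∀ θ, ρ * expInt 1 θ ∈ Metric.ball (0 : ℂ) 1 := fun θ => by
    rw [mem_ball_zero_iff, norm_mul, norm_expInt, mul_one, Complex.norm_real,
      Real.norm_of_nonneg hρ0.le]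
    exact hρ1
  have hGc : Continuous G := hΨ.differentiableOn.continuousOn.comp_continuous
    (continuous_const.mul (continuous_expInt _)) hGmem
  have hPc : Continuous P := hQ.differentiableOn.continuousOn.comp_continuous
    (continuous_const.mul (continuous_expInt _)) hPmem
  set s : ℕ → ℂ := fun m => q m * ρ ^ m with hs
  set r : ℕ → ℂ := fun k => c k * y ^ k with hr
  have hssum : Summable fun m => ‖s m‖ := (hQ.summable_norm hρ0.le hρ1).congr fun m => by
    rw [hs, norm_mul, norm_pow, Complex.norm_real, Real.norm_of_nonneg hρ0.le]
  have hrsum : Summable fun k => ‖r k‖ := (hΨ.summable_norm (norm_nonneg y) hy1).congr fun k => by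
    rw [hr, norm_mul, norm_pow]
  have hPs : ∀ θ, HasSum (fun m => s m * expInt m θ) (P θ) := fun θ => by
    convert! hQ _ (hPmem θ) using 2 with m
    rw [hs, mul_pow, expInt_pow, mul_one, mul_assoc]
  have hGs : ∀ θ, HasSum (fun k => r k * expInt (-k) θ) (G θ) := fun θ => by
    convert! hΨ _ (hGmem θ) using 2 with k
    rw [hr, mul_pow, expInt_pow, mul_neg_one, mul_assoc]
  have hPs' : ∀ θ, HasSum (fun m => (starRingEnd ℂ) (s m) * expInt (-m) θ)
      ((starRingEnd ℂ) (P θ)) := fun θ => by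
    convert! (hPs θ).map (starRingEnd ℂ) Complex.continuous_conj using 2 with m
    simp [conj_expInt]
  -- `G` contains only the frequencies -k with k ≥ 0: pairing with frequency m ≥ 0 extracts `r m`,
  -- and pairing with a negative frequency gives 0. Thus `P` times `G` integrates to the Hadamard
  -- product, while the conjugate of `P` contributes only its constant term.
  have hcoef : ∀ n : ℤ, HasSum (fun k : ℕ => r k * (if n = k then 2 * (Real.pi : ℂ) else 0))
      (∫ θ in (0 : ℝ)..2 * Real.pi, expInt n θ * G θ) := fun n => by
    convert! hasSum_integral_mul hrsum (fun k => continuous_expInt (-k))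
      (fun k θ => norm_expInt _ θ) hGs (continuous_expInt n) 0 (2 * Real.pi) using 1
    · ext k
      simp only [expInt_mul, integral_expInt]
      congr 2
      exact propext ⟨fun h => by omega, fun h => by omega⟩
    · simp only [mul_comm]
  have hcoef1 : ∀ m : ℕ, ∫ θ in (0 : ℝ)..2 * Real.pi, expInt m θ * G θ =
      r m * (2 * Real.pi) := fun m => by
    refine (hcoef m).unique ?_
    convert! hasSum_single (f := fun k : ℕ => r k * (if (m : ℤ) = k then 2 * (Real.pi : ℂ) else 0))
      m ?_ using 1
    · simp
    · intro k hk
      rw [if_neg (by omega), mul_zero]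
  have hcoef2 : ∀ m : ℕ, m ≠ 0 → ∫ θ in (0 : ℝ)..2 * Real.pi, expInt (-m) θ * G θ = 0 :=
    fun m hm => by
    have h := hcoef (-m)
    have e : (fun k : ℕ => r k * (if -(m : ℤ) = k then 2 * (Real.pi : ℂ) else 0)) =
        fun _ => 0 := funext fun k => by rw [if_neg (by omega), mul_zero]
    rw [e] at h
    exact h.unique hasSum_zero
  have hI1 : ∫ θ in (0 : ℝ)..2 * Real.pi, P θ * G θ = X * (2 * Real.pi) := by
    refine (hasSum_integral_mul hssum (fun k => continuous_expInt k)
      (fun k θ => norm_expInt _ θ) hPs hGc 0 (2 * Real.pi)).unique ?_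
    convert! hX.mul_right (2 * (Real.pi : ℂ)) using 2 with m
    simp only [hcoef1, hs, hr, hy, div_pow]
    field_simp
  have hI2 : ∫ θ in (0 : ℝ)..2 * Real.pi, (starRingEnd ℂ) (P θ) * G θ =
      (starRingEnd ℂ) (q 0) * (2 * Real.pi) := by
    refine (hasSum_integral_mul (by simpa using hssum) (fun k => continuous_expInt (-k))
      (fun k θ => norm_expInt _ θ) hPs' hGc 0 (2 * Real.pi)).unique ?_
    convert! hasSum_single (f := fun k : ℕ => (starRingEnd ℂ) (s k) *
      ∫ θ in (0 : ℝ)..2 * Real.pi, expInt (-k) θ * G θ) 0 ?_ using 1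
    · have h0 := hcoef1 0
      simp only [Nat.cast_zero] at h0
      simp [h0, hs, hr, hc]
    · intro k hk
      rw [hcoef2 k hk, mul_zero]
  have hI3 : ∫ θ in (0 : ℝ)..2 * Real.pi, P θ = q 0 * (2 * Real.pi) := by
    have h := hasSum_integral_mul hssum (fun k => continuous_expInt k)
      (fun k θ => norm_expInt _ θ) hPs (continuous_const (y := (1 : ℂ))) 0 (2 * Real.pi)
    simp only [mul_one, integral_expInt] at h
    refine h.unique ?_
    convert! hasSum_single (f := fun k : ℕ => s k *
      if (k : ℤ) = 0 then 2 * (Real.pi : ℂ) else 0) 0 ?_ using 1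
    · simp [hs]
    · intro k hk
      rw [if_neg (by omega), mul_zero]
  have hre : ∀ F : ℝ → ℂ, Continuous F → ∫ θ in (0 : ℝ)..2 * Real.pi, (F θ).re =
      (∫ θ in (0 : ℝ)..2 * Real.pi, F θ).re := fun F hF =>
    Complex.reCLM.intervalIntegral_comp_comm (hF.intervalIntegrable _ _)
  -- Both factors are positive. Expanding by 2 Re P Re G = Re(PG) + Re(conj(P)G) gives 2π(Re X + Re
  -- q₀ - 2κ Re q₀).
  have hpos : 0 < ∫ θ in (0 : ℝ)..2 * Real.pi, 2 * (P θ).re * ((G θ).re - κ) := by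
    refine intervalIntegral.intervalIntegral_pos_of_pos_on
      (Continuous.intervalIntegrable (by fun_prop) _ _) (fun θ _ => ?_) (by positivity)
    have h1 := hQpos _ (hPmem θ)
    have h2 := sub_pos.2 (hΨκ _ (hGmem θ))
    exact mul_pos (mul_pos two_pos h1) h2
  have e : ∀ θ, 2 * (P θ).re * ((G θ).re - κ) =
      ((P θ * G θ).re + ((starRingEnd ℂ) (P θ) * G θ).re) - 2 * κ * (P θ).re := fun θ => by
    simp only [Complex.mul_re, Complex.conj_re, Complex.conj_im]
    ring
  have c1 : Continuous fun θ => P θ * G θ := hPc.mul hGc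
  have c2 : Continuous fun θ => (starRingEnd ℂ) (P θ) * G θ :=
    (Complex.continuous_conj.comp hPc).mul hGc
  have i1 : IntervalIntegrable (fun θ => (P θ * G θ).re) volume 0 (2 * Real.pi) :=
    (Complex.continuous_re.comp c1).intervalIntegrable _ _
  have i2 : IntervalIntegrable (fun θ => ((starRingEnd ℂ) (P θ) * G θ).re) volume 0
    (2 * Real.pi) := (Complex.continuous_re.comp c2).intervalIntegrable _ _
  have i3 : IntervalIntegrable (fun θ => 2 * κ * (P θ).re) volume 0 (2 * Real.pi) :=
    (continuous_const.mul (Complex.continuous_re.comp hPc)).intervalIntegrable _ _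
  simp only [e] at hpos
  rw [intervalIntegral.integral_sub (i1.add i2) i3, intervalIntegral.integral_add i1 i2,
    intervalIntegral.integral_const_mul, hre _ c1, hre _ c2, hre _ hPc, hI1, hI2, hI3] at hpos
  have e2 : ∀ w : ℂ, (w * (2 * Real.pi)).re = w.re * (2 * Real.pi) := fun w => by
    simp [Complex.mul_re]
  simp only [e2, Complex.conj_re] at hpos
  have h3 : 0 < (X.re - (2 * κ - 1) * (q 0).re) * (2 * Real.pi) := by linarith
  have h4 := (mul_pos_iff_of_pos_right (by positivity : (0 : ℝ) < 2 * Real.pi)).1 h3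
  linarith

/-! ### The functions h_ε and the kernel `psi` -/

theorem hasPS_const (c : ℂ) : HasPS (fun n => if n = 0 then c else 0) fun _ => c := by
  intro z _
  convert! hasSum_single (f := fun n : ℕ => (if n = 0 then c else 0) * z ^ n) 0 ?_ using 1
  · simp
  · intro n hn
    simp [hn]

theorem hasPS_geometric : HasPS (fun _ => 1) fun z => (1 - z)⁻¹ := fun z hz => by
  simpa using hasSum_geometric_of_norm_lt_one (mem_ball_zero_iff.1 hz)

theorem one_sub_ne_zero_of_mem_ball {z : ℂ} (hz : z ∈ Metric.ball (0 : ℂ) 1) : 1 - z ≠ 0 := by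
  intro h
  rw [← sub_eq_zero.1 h] at hz
  simp at hz

theorem hasPS_nat : HasPS (fun n => (n : ℂ)) fun z => z / (1 - z) ^ 2 := fun _ hz =>
  hasSum_coe_mul_geometric_of_norm_lt_one (mem_ball_zero_iff.1 hz)

/-- The Taylor coefficients of `h_ε`. -/
theorem hasPS_hfun (ε : ℂ) :
    HasPS (fun n => (1 - (1 + ε) / 2) * (if n = 0 then 0 else 1) + (1 + ε) / 2 * n)
      (hfun ε) := by
  have h1 : HasPS (fun n => if n = 0 then 0 else 1) fun z => z * (1 - z)⁻¹ :=
    hasPS_geometric.id_mul (by simp) fun n => by simp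
  refine ((h1.const_mul (1 - (1 + ε) / 2)).add (hasPS_nat.const_mul ((1 + ε) / 2))).congr
    (fun n => rfl) fun z hz => ?_
  have hz1 := one_sub_ne_zero_of_mem_ball hz
  rw [hfun]
  field_simp
  ring

theorem koebeMin_eq (ξ t : ℝ) : koebeMin ξ t =
    (1 - ξ) * (1 / (1 + |t|) ^ 2) + ξ * ((1 - |t|) / (1 + |t|) ^ 3) := by
  rw [koebeMin]
  ring

theorem continuous_koebeMin (ξ : ℝ) : Continuous (koebeMin ξ) := by
  rw [funext (koebeMin_eq ξ)]
  exact (continuous_inv_sq.const_mul (1 - ξ)).add (continuous_koebe_deriv.const_mul ξ)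

theorem abs_koebeMin_le (ξ t : ℝ) : |koebeMin ξ t| ≤ |1 - ξ| + |ξ| := by
  rw [koebeMin_eq]
  refine (abs_add_le _ _).trans ?_
  rw [abs_mul, abs_mul]
  gcongr
  · exact mul_le_of_le_one_right (abs_nonneg _) (abs_inv_sq_le t)
  · exact mul_le_of_le_one_right (abs_nonneg _) (abs_koebe_deriv_le t)

/-- The combination `(1 - ξ) h(z)/z + ξ h'(z)`. -/
noncomputable def hComb (ξ : ℝ) (h : ℂ → ℂ) (z : ℂ) : ℂ :=
  (1 - (ξ : ℂ)) * dslope h 0 z + (ξ : ℂ) * deriv h z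

theorem hasPS_hComb (ξ : ℝ) (ε : ℂ) :
    HasPS (fun m => (1 + ξ * m) * (1 + (1 + ε) / 2 * m)) (hComb ξ (hfun ε)) := by
  have h := hasPS_hfun ε
  refine (((h.dslope (by simp)).const_mul (1 - (ξ : ℂ))).add (h.deriv.const_mul (ξ : ℂ))).congr
    (fun m => ?_) fun z _ => rfl
  rw [if_neg m.succ_ne_zero]
  push_cast
  ring

/-- For ε = 1 the function is the Koebe function, and the terms subtracted in N_Π are its values on
the negative radius. This is the source of sharpness. -/
theorem hComb_hfun_one (ξ : ℝ) {x : ℝ} (hx0 : 0 < x) (hx1 : x < 1) :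
    hComb ξ (hfun 1) (-x : ℝ) = (koebeMin ξ x : ℝ) := by
  have hxC : (x : ℂ) ≠ 0 := Complex.ofReal_ne_zero.2 hx0.ne'
  have h1 : (1 : ℂ) + x ≠ 0 := by
    rw [← Complex.ofReal_one, ← Complex.ofReal_add]
    exact Complex.ofReal_ne_zero.2 (by linarith)
  have hf : hfun 1 = fun z : ℂ => z / (1 - z) ^ 2 := by
    ext z
    simp [hfun]
  have hd : HasDerivAt (fun z : ℂ => z / (1 - z) ^ 2)
      ((1 * (1 - (-x : ℂ)) ^ 2 - (-x : ℂ) * (((2 : ℕ) : ℂ) * (1 - (-x : ℂ)) ^ 1 * (-1))) /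
        ((1 - (-x : ℂ)) ^ 2) ^ 2) (-x : ℂ) := by
    have h2 : HasDerivAt (fun z : ℂ => 1 - z) (-1) (-x : ℂ) := by
      simpa using (hasDerivAt_id (-x : ℂ)).const_sub 1
    exact (hasDerivAt_id _).div (h2.pow 2) (pow_ne_zero 2 (by rwa [sub_neg_eq_add]))
  rw [hComb, Complex.ofReal_neg, dslope_of_ne _ (neg_ne_zero.2 hxC), slope_def_field, hf, hd.deriv,
    koebeMin, abs_of_pos hx0]
  push_cast
  simp only [sub_neg_eq_add, sub_zero, zero_div]
  field_simp
  ring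

/-- `Σ (1+ξm)(1+m(1+ε)/2) τ_m / ((1+μm)(1+νm)) z^m`, in integral form. -/
noncomputable def psi (lam : ℝ → ℝ) (μ ν ξ : ℝ) (ε z : ℂ) : ℂ :=
  1 / (μ * ν : ℂ) * ∫ t in (0 : ℝ)..1,
    ((t ^ (1 / μ - 1) * PiFun lam μ ν t : ℝ) : ℂ) * hComb ξ (hfun ε) (t * z)

/-- The Taylor coefficients of `psi`. -/
noncomputable def psiCoef (lam : ℝ → ℝ) (μ ν ξ : ℝ) (ε : ℂ) (m : ℕ) : ℂ :=
  (1 + ξ * m) * (1 + (1 + ε) / 2 * m) *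
    (((∫ t in (0 : ℝ)..1, lam t * t ^ m : ℝ) : ℂ) / ((1 + μ * m) * (1 + ν * m)))

section

variable {lam : ℝ → ℝ} {μ ν ξ : ℝ}

theorem weight_intervalIntegrable (hμ : 0 < μ) (hν : 0 < ν)
    (hlam : IntervalIntegrable lam volume 0 1) :
    IntervalIntegrable (fun t => t ^ (1 / μ - 1) * PiFun lam μ ν t) volume 0 1 := by
  have h := (integral_piFun hμ hν hlam.1 (φ := fun _ => 1) (M := 1) continuous_const
    (by simp)).1
  simp only [mul_one] at h
  exact (intervalIntegrable_iff_integrableOn_Ioc_of_le zero_le_one).2 h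

theorem one_add_mul_natCast_ne_zero (hμ : 0 < μ) (m : ℕ) : (1 + μ * m : ℂ) ≠ 0 := by
  have h : (1 + μ * m : ℝ) ≠ 0 := by positivity
  exact_mod_cast Complex.ofReal_ne_zero.2 h

theorem hasPS_psi (hμ : 0 < μ) (hν : 0 < ν) (hlam : IntervalIntegrable lam volume 0 1) (ε : ℂ) :
    HasPS (psiCoef lam μ ν ξ ε) (psi lam μ ν ξ ε) := by
  refine (((hasPS_hComb ξ ε).integral_weight
    (weight_intervalIntegrable hμ hν hlam)).const_mul (1 / (μ * ν : ℂ))).congr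
    (fun m => ?_) fun z _ => rfl
  rw [moment_piFun hμ hν hlam.1, psiCoef]
  have h1 : (μ : ℂ) ≠ 0 := Complex.ofReal_ne_zero.2 hμ.ne'
  have h2 : (ν : ℂ) ≠ 0 := Complex.ofReal_ne_zero.2 hν.ne'
  push_cast
  field_simp

theorem psiCoef_zero (hlam1 : ∫ t in (0 : ℝ)..1, lam t = 1) (ε : ℂ) :
    psiCoef lam μ ν ξ ε 0 = 1 := by
  simp [psiCoef, hlam1]

theorem re_psi (hμ : 0 < μ) (hν : 0 < ν) (hlam : IntervalIntegrable lam volume 0 1)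
    (ε : ℂ) {z : ℂ} (hz : z ∈ Metric.ball (0 : ℂ) 1) :
    IntervalIntegrable (fun t => t ^ (1 / μ - 1) * PiFun lam μ ν t *
      (hComb ξ (hfun ε) (t * z)).re) volume 0 1 ∧
    μ * ν * (psi lam μ ν ξ ε z).re =
      ∫ t in (0 : ℝ)..1, t ^ (1 / μ - 1) * PiFun lam μ ν t * (hComb ξ (hfun ε) (t * z)).re := by
  have hw := weight_intervalIntegrable hμ hν hlam
  have hc : ContinuousOn (fun t : ℝ => hComb ξ (hfun ε) (t * z)) (uIcc 0 1) := by
    rw [uIcc_of_le zero_le_one]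
    refine (hasPS_hComb ξ ε).differentiableOn.continuousOn.comp (by fun_prop) fun t ht => ?_
    exact ofReal_mul_mem_ball ht.1 ht.2 hz
  have hi : IntervalIntegrable (fun t : ℝ => ((t ^ (1 / μ - 1) * PiFun lam μ ν t : ℝ) : ℂ) *
      hComb ξ (hfun ε) (t * z)) volume 0 1 :=
    IntervalIntegrable.mul_continuousOn ⟨hw.1.ofReal, hw.2.ofReal⟩ hc
  refine ⟨hw.mul_continuousOn (Complex.continuous_re.comp_continuousOn hc), ?_⟩
  have h := Complex.reCLM.intervalIntegral_comp_comm hi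
  simp only [Complex.reCLM_apply, Complex.re_ofReal_mul] at h
  rw [h, psi]
  have e : (1 / (μ * ν : ℂ)) = ((1 / (μ * ν) : ℝ) : ℂ) := by push_cast; rfl
  rw [e, Complex.re_ofReal_mul, ← mul_assoc, mul_one_div_cancel (mul_pos hμ hν).ne', one_mul]

/-! ### Lower bounds for Re `psi` -/

/-- Non-negativity of `N_Π(h_ε)` bounds the real part of `psi` from below. -/
theorem nPi_nonneg_iff (hμ : 0 < μ) (hν : 0 < ν) (hlam : IntervalIntegrable lam volume 0 1)
    {c : ℝ} (hc : ∫ t in (0 : ℝ)..1, t ^ (1 / μ - 1) * PiFun lam μ ν t * koebeMin ξ t = μ * ν * c)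
    (ε : ℂ) :
    0 ≤ NPi lam μ ν ξ (hfun ε) ↔
      ∀ z ∈ Metric.ball (0 : ℂ) 1, c ≤ (psi lam μ ν ξ ε z).re := by
  have hk : IntervalIntegrable (fun t => t ^ (1 / μ - 1) * PiFun lam μ ν t * koebeMin ξ t)
      volume 0 1 := by
    exact (weight_intervalIntegrable hμ hν hlam).mul_continuousOn (continuous_koebeMin ξ).continuousOn
  rw [NPi, le_iInf₂_iff]
  refine forall₂_congr fun z hz => ?_
  obtain ⟨hi, he⟩ := re_psi (ξ := ξ) hμ hν hlam ε hz
  have e : ∫ t in (0 : ℝ)..1, t ^ (1 / μ - 1) * PiFun lam μ ν t * L ξ (hfun ε) z t =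
      μ * ν * ((psi lam μ ν ξ ε z).re - c) := by
    rw [mul_sub, he, ← hc, ← intervalIntegral.integral_sub hi hk]
    refine intervalIntegral.integral_congr fun t ht => ?_
    rw [uIcc_of_le zero_le_one] at ht
    simp only [L, hComb, koebeMin, abs_of_nonneg ht.1]
    have e1 : (1 - (ξ : ℂ)) = ((1 - ξ : ℝ) : ℂ) := by push_cast; rfl
    rw [e1, Complex.add_re, Complex.re_ofReal_mul, Complex.re_ofReal_mul]
    ring
  rw [e, EReal.coe_nonneg, mul_nonneg_iff_of_pos_left (mul_pos hμ hν), sub_nonneg]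

/-- The lower bound is attained in the limit `z → -1` for the Koebe function. -/
theorem le_of_forall_le_re_psi (hμ : 0 < μ) (hν : 0 < ν)
    (hlam : IntervalIntegrable lam volume 0 1)
    {c b : ℝ} (hc : ∫ t in (0 : ℝ)..1, t ^ (1 / μ - 1) * PiFun lam μ ν t * koebeMin ξ t =
      μ * ν * c)
    (h : ∀ z ∈ Metric.ball (0 : ℂ) 1, b ≤ (psi lam μ ν ξ 1 z).re) : b ≤ c := by
  have hw := weight_intervalIntegrable hμ hν hlam
  have hk := continuous_koebeMin ξ
  -- The absolute values in `koebeMin` keep it continuous and bounded for every real r, so the limit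
  -- r → 1 follows from dominated convergence.
  have hcont : Continuous fun r : ℝ =>
      ∫ t in (0 : ℝ)..1, t ^ (1 / μ - 1) * PiFun lam μ ν t * koebeMin ξ (t * r) := by
    refine intervalIntegral.continuous_of_dominated_interval
      (bound := fun t => |t ^ (1 / μ - 1) * PiFun lam μ ν t| * (|1 - ξ| + |ξ|)) ?_ ?_ ?_ ?_
    · intro r
      rw [uIoc_of_le zero_le_one]
      exact hw.1.aestronglyMeasurable.mul
        (hk.comp (continuous_mul_const r)).aestronglyMeasurable
    · intro r
      refine Eventually.of_forall fun t _ => ?_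
      rw [norm_mul, Real.norm_eq_abs, Real.norm_eq_abs]
      gcongr
      exact abs_koebeMin_le ξ _
    · exact hw.abs.mul_const _
    · exact Eventually.of_forall fun t _ =>
        continuous_const.mul (hk.comp (continuous_const_mul t))
  have hlim := (hcont.tendsto 1).mono_left (nhdsWithin_le_nhds (s := Iio 1))
  simp only [mul_one, hc] at hlim
  have hle : μ * ν * b ≤ μ * ν * c := by
    refine ge_of_tendsto hlim ?_
    filter_upwards [(lt_mem_nhds zero_lt_one).filter_mono nhdsWithin_le_nhds,
      self_mem_nhdsWithin] with r hr0 hr1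
    have hr1' : r < 1 := hr1
    have hz : ((-r : ℝ) : ℂ) ∈ Metric.ball (0 : ℂ) 1 := by
      rw [Complex.ofReal_neg, mem_ball_zero_iff, norm_neg, ← mem_ball_zero_iff]
      exact ofReal_mem_ball hr0.le hr1'
    have h1 := (re_psi (ξ := ξ) hμ hν hlam 1 hz).2
    have h2 := mul_le_mul_of_nonneg_left (h _ hz) (mul_pos hμ hν).le
    rw [h1] at h2
    refine h2.trans_eq ?_
    rw [intervalIntegral.integral_of_le zero_le_one, intervalIntegral.integral_of_le zero_le_one]
    refine setIntegral_congr_fun measurableSet_Ioc fun t ht => ?_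
    have h3 := hComb_hfun_one ξ (x := t * r) (mul_pos ht.1 hr0) (by nlinarith [ht.1, ht.2])
    have e : (t : ℂ) * ((-r : ℝ) : ℂ) = ((-(t * r) : ℝ) : ℂ) := by
      push_cast
      ring
    simp only [e, h3, Complex.ofReal_re]
  exact le_of_mul_le_mul_left hle (mul_pos hμ hν)

/-! ### The transform V_λ and the convolution with h_ε -/

theorem hasPS_V (hlam : IntervalIntegrable lam volume 0 1) {a : ℕ → ℂ} {f : ℂ → ℂ}
    (hf : HasPS a f) (h0 : a 0 = 0) :
    HasPS (fun n => a n * ((∫ t in (0 : ℝ)..1, lam t * t ^ (n - 1) : ℝ) : ℂ)) (V lam f) := by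
  -- V_λ integrates f(tz)/(tz) and multiplies by z, which shifts the moment index to n - 1. The
  -- truncated subtraction at n = 0 is harmless because `a 0 = 0`.
  refine (((hf.dslope h0).integral_weight hlam).id_mul
    (b := fun n => a n * ((∫ t in (0 : ℝ)..1, lam t * t ^ (n - 1) : ℝ) : ℂ))
    (by simp [h0]) fun n => rfl).congr (fun _ => rfl) fun z _ => ?_
  rw [V, ← intervalIntegral.integral_const_mul, intervalIntegral.integral_of_le zero_le_one,
    intervalIntegral.integral_of_le zero_le_one]
  refine setIntegral_congr_fun measurableSet_Ioc fun t ht => ?_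
  have ht0 : (t : ℂ) ≠ 0 := Complex.ofReal_ne_zero.2 ht.1.ne'
  have h1 := eq_mul_dslope (K := f) (by rw [hf.apply_zero, h0]) (t * z)
  rw [h1]
  field_simp

/-- A power series with the normalization of `ClassA`. -/
theorem HasPS.mem_classA {a : ℕ → ℂ} {f : ℂ → ℂ} (hf : HasPS a f) (h0 : a 0 = 0) (h1 : a 1 = 1) :
    f ∈ ClassA :=
  ⟨hf.differentiableOn, by rw [hf.apply_zero, h0], by
    rw [hf.deriv.apply_zero]
    simp [h1]⟩

theorem exists_hasPS_of_mem_classA {f : ℂ → ℂ} (hf : f ∈ ClassA) :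
    ∃ a, HasPS a f ∧ a 0 = 0 ∧ a 1 = 1 := by
  obtain ⟨a, ha⟩ := exists_hasPS hf.1
  refine ⟨a, ha, ?_, ?_⟩
  · rw [← ha.apply_zero, hf.2.1]
  · have h := ha.deriv.apply_zero
    rw [hf.2.2] at h
    simpa using h.symm

theorem V_mem_classA (hlam : IntervalIntegrable lam volume 0 1)
    (hlam1 : ∫ t in (0 : ℝ)..1, lam t = 1) {f : ℂ → ℂ} (hf : f ∈ ClassA) :
    V lam f ∈ ClassA := by
  obtain ⟨a, ha, h0, h1⟩ := exists_hasPS_of_mem_classA hf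
  exact (hasPS_V hlam ha h0).mem_classA (by simp [h0]) (by simp [h1, hlam1])

/-- The convolution of `ξ z F' + (1 - ξ) F` with `h_ε`. -/
noncomputable def pascuConv (ξ : ℝ) (ε : ℂ) (F : ℂ → ℂ) (z : ℂ) : ℂ :=
  (1 - ε) / 2 * pascuComb ξ F z + (1 + ε) / 2 * (z * deriv (pascuComb ξ F) z)

/-- The factors (1+μm)(1+νm) of the operator cancel the denominators of `psiCoef`, so the
convolution divided by z is the Hadamard product of the operator with `psi`. -/
theorem exists_pascuConv_eq (hμ : 0 < μ) (hν : 0 < ν) (hlam : IntervalIntegrable lam volume 0 1)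
    {a : ℕ → ℂ} {f : ℂ → ℂ} (hf : HasPS a f) (h0 : a 0 = 0) (ε : ℂ) :
    ∃ X : ℂ → ℂ,
      HasPS (fun m => (1 + μ * m) * (1 + ν * m) * a (m + 1) * psiCoef lam μ ν ξ ε m) X ∧
      ∀ z, pascuConv ξ ε (V lam f) z = z * X z := by
  have hV := hasPS_V hlam hf h0
  have hK : HasPS _ (pascuComb ξ (V lam f)) :=
    (hV.id_mul_deriv.const_mul (ξ : ℂ)).add (hV.const_mul (1 - (ξ : ℂ)))
  have hC : HasPS _ (pascuConv ξ ε (V lam f)) :=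
    (hK.const_mul ((1 - ε) / 2)).add (hK.id_mul_deriv.const_mul ((1 + ε) / 2))
  refine ⟨dslope (pascuConv ξ ε (V lam f)) 0, (hC.dslope (by simp [h0])).congr (fun m => ?_)
    fun _ _ => rfl, eq_mul_dslope (by rw [hC.apply_zero]; simp [h0])⟩
  have h1 := one_add_mul_natCast_ne_zero hμ m
  have h2 := one_add_mul_natCast_ne_zero hν m
  rw [psiCoef, Nat.add_sub_cancel]
  generalize (1 + μ * m : ℂ) = A at h1 ⊢
  generalize (1 + ν * m : ℂ) = B at h2 ⊢
  field_simp
  push_cast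
  ring

/-- The quadratic in m obtained from α and γ factors as (1+μm)(1+νm); this is the purpose of μ and
ν. -/
theorem hasPS_operator {α γ : ℝ} (hsum : μ + ν = α - γ) (hprod : μ * ν = γ)
    {a : ℕ → ℂ} {f : ℂ → ℂ} (hf : HasPS a f) (h0 : a 0 = 0) :
    HasPS (fun m => (1 + μ * m) * (1 + ν * m) * a (m + 1))
      (fun z => (1 - α + 2 * γ : ℂ) * dslope f 0 z + (α - 2 * γ : ℂ) * deriv f z
        + (γ : ℂ) * z * deriv (deriv f) z) := by
  refine ((((hf.dslope h0).const_mul (1 - α + 2 * γ : ℂ)).add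
    (hf.deriv.const_mul (α - 2 * γ : ℂ))).add
    (hf.deriv.id_mul_deriv.const_mul (γ : ℂ))).congr (fun m => ?_) fun z _ => by ring
  have hα : α = μ + ν + μ * ν := by linarith
  rw [hα, ← hprod]
  push_cast
  ring

/-- If w = zK'/K is purely imaginary, then ε = (1+w)/(1-w) is unimodular and makes the convolution
vanish. So Re zK'/K has no zero on the disc; being continuous with value 1 at the origin, it stays
positive. -/
theorem mem_classM_of_pascuConv_ne_zero {F : ℂ → ℂ} (hF : F ∈ ClassA)
    (h : ∀ ε : ℂ, ‖ε‖ = 1 → ∀ z ∈ Metric.ball (0 : ℂ) 1, z ≠ 0 → pascuConv ξ ε F z ≠ 0) :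
    F ∈ ClassM ξ := by
  rw [mem_classM_iff hF]
  obtain ⟨hd, h0, h1⟩ := pascuComb_mem_classA (ξ := ξ) hF
  set K := pascuComb ξ F
  have hKne : ∀ z ∈ Metric.ball (0 : ℂ) 1, z ≠ 0 → K z ≠ 0 := fun z hz hz0 hK => by
    -- At ε = -1 the convolution is K itself, so K has no zero except at 0.
    refine h (-1) (by simp) z hz hz0 ?_
    rw [pascuConv, show pascuComb ξ F z = 0 from hK]
    ring
  have hball : Metric.ball (0 : ℂ) 1 ∈ 𝓝 (0 : ℂ) := Metric.ball_mem_nhds _ one_pos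
  have hD := (Complex.differentiableOn_dslope hball).2 hd
  have hDne : ∀ x ∈ Metric.ball (0 : ℂ) 1, dslope K 0 x ≠ 0 := fun x hx => by
    rcases eq_or_ne x 0 with rfl | hx0
    · simp [h1]
    · have := hKne x hx hx0
      rw [eq_mul_dslope h0] at this
      exact right_ne_zero_of_mul this
  have hq : ∀ x, x ≠ 0 → deriv K x / dslope K 0 x = x * deriv K x / K x := fun x hx => by
    rw [eq_mul_dslope h0 x]
    field_simp
  set p : ℂ → ℝ := fun x => (deriv K x / dslope K 0 x).re with hp
  have hpc : ContinuousOn p (Metric.ball 0 1) := Complex.continuous_re.comp_continuousOn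
    ((hd.deriv Metric.isOpen_ball).div hD hDne).continuousOn
  have hp0 : p 0 = 1 := by simp [hp, h1]
  have hpne : ∀ x ∈ Metric.ball (0 : ℂ) 1, p x ≠ 0 := fun x hx hx0 => by
    rcases eq_or_ne x 0 with rfl | hxne
    · rw [hp0] at hx0
      exact one_ne_zero hx0
    simp only [hp] at hx0
    rw [hq x hxne] at hx0
    set w := x * deriv K x / K x with hw
    have hw1 : 1 - w ≠ 0 := fun h => by
      have := congrArg Complex.re h
      simp [hx0] at this
    refine h ((1 + w) / (1 - w)) ?_ x hx hxne ?_
    · rw [norm_div, div_eq_one_iff_eq (norm_ne_zero_iff.2 hw1), Complex.norm_def, Complex.norm_def,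
        Complex.normSq_apply, Complex.normSq_apply]
      simp [hx0]
    · have hK0 := hKne x hx hxne
      have e : x * deriv K x = w * K x := by rw [hw, div_mul_cancel₀ _ hK0]
      show (1 - (1 + w) / (1 - w)) / 2 * K x + (1 + (1 + w) / (1 - w)) / 2 * (x * deriv K x) = 0
      rw [e]
      field_simp
      ring
  intro z hz hz0
  rw [← hq z hz0]
  by_contra hneg
  obtain ⟨x, hx, hx0⟩ := ((convex_ball (0 : ℂ) 1).isPreconnected.image p hpc).Icc_subset
    (mem_image_of_mem p hz) (mem_image_of_mem p (Metric.mem_ball_self one_pos))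
    (show (0 : ℝ) ∈ Icc (p z) (p 0) from ⟨not_lt.1 hneg, by rw [hp0]; exact zero_le_one⟩)
  exact hpne x hx hx0

theorem pascuConv_ne_zero_of_mem_classM {F : ℂ → ℂ} (hF : F ∈ ClassM ξ) {ε : ℂ} (hε : ‖ε‖ = 1)
    {z : ℂ} (hz : z ∈ Metric.ball (0 : ℂ) 1) (hz0 : z ≠ 0) : pascuConv ξ ε F z ≠ 0 := by
  intro h
  have hpos := (mem_classM_iff hF.1).1 hF z hz hz0
  have hK0 : pascuComb ξ F z ≠ 0 := fun h0 => by simp [h0] at hpos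
  set w := z * deriv (pascuComb ξ F) z / pascuComb ξ F z with hw
  have e : z * deriv (pascuComb ξ F) z = w * pascuComb ξ F z := by
    rw [hw, div_mul_cancel₀ _ hK0]
  rw [pascuConv, e] at h
  have h1 : (1 + ε) * w = -(1 - ε) := by
    have : pascuComb ξ F z * ((1 - ε) + (1 + ε) * w) = 0 := by linear_combination 2 * h
    linear_combination (mul_eq_zero.1 this).resolve_left hK0
  have hn : ε.re ^ 2 + ε.im ^ 2 = 1 := by
    have := Complex.sq_norm ε
    rw [hε, Complex.normSq_apply] at this
    linarith
  have hr := congrArg Complex.re h1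
  have hi := congrArg Complex.im h1
  simp only [Complex.mul_re, Complex.mul_im, Complex.add_re, Complex.add_im, Complex.one_re,
    Complex.one_im, Complex.neg_re, Complex.neg_im, Complex.sub_re, Complex.sub_im] at hr hi
  -- Multiplying (1+ε)w = -(1-ε) by the conjugate of 1+ε gives |1+ε|²w = ε - conj(ε), which is
  -- imaginary. Either Re w = 0 or ε = -1, and the latter reads 0 = -2.
  have h2 : ((1 + ε.re) ^ 2 + ε.im ^ 2) * w.re = 0 := by
    linear_combination (1 + ε.re) * hr + ε.im * hi + hn
  rcases mul_eq_zero.1 h2 with h3 | h3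
  · have h4 : ε.im = 0 := by nlinarith [sq_nonneg (1 + ε.re), sq_nonneg ε.im]
    have h5 : ε.re = -1 := by nlinarith [sq_nonneg (1 + ε.re), sq_nonneg ε.im]
    rw [h4, h5] at hr
    norm_num at hr
  · exact hpos.ne' h3

end

/-! ### Duality between W_β and the bound on Re `psi` -/

section

variable {lam : ℝ → ℝ} {μ ν ξ α γ : ℝ}

/-- The Hadamard inequality is applied to e^{iφ}(H-β), H the operator, with κ = 1 - 1/(2(1-β)). This
κ satisfies (2κ-1)(1-β) = -β, so a zero of the product would turn the strict inequality into an
equality. -/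
theorem V_mem_classM_of_le_re_psi (hμ : 0 < μ) (hν : 0 < ν) (hsum : μ + ν = α - γ)
    (hprod : μ * ν = γ) (hlam : IntervalIntegrable lam volume 0 1)
    (hlam1 : ∫ t in (0 : ℝ)..1, lam t = 1) {β : ℝ} (hβ : β < 1)
    (h : ∀ ε : ℂ, ‖ε‖ = 1 → ∀ z ∈ Metric.ball (0 : ℂ) 1,
      1 - 1 / (2 * (1 - β)) ≤ (psi lam μ ν ξ ε z).re)
    {f : ℂ → ℂ} (hf : f ∈ ClassW α γ β) : V lam f ∈ ClassM ξ := by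
  have hβ' : 0 < 1 - β := sub_pos.2 hβ
  obtain ⟨hfA, φ, hφ⟩ := hf
  obtain ⟨a, ha, h0, h1⟩ := exists_hasPS_of_mem_classA hfA
  refine mem_classM_of_pascuConv_ne_zero (V_mem_classA hlam hlam1 hfA)
    fun ε hε z hz hz0 hzero => ?_
  obtain ⟨X, hX, hXe⟩ := exists_pascuConv_eq (ξ := ξ) hμ hν hlam ha h0 ε
  have hXz : X z = 0 := by
    rw [hXe] at hzero
    exact (mul_eq_zero.1 hzero).resolve_left hz0
  have hψ := hasPS_psi (ξ := ξ) hμ hν hlam ε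
  have hψ0 := psiCoef_zero (μ := μ) (ν := ν) (ξ := ξ) hlam1 ε
  have hstrict := re_lt_of_re_le hψ.differentiableOn (h ε hε) (by
    rw [hψ.apply_zero, hψ0, Complex.one_re]
    have : 0 < 1 / (2 * (1 - β)) := by positivity
    linarith)
  set u : ℂ := Complex.exp (φ * Complex.I) with hu
  have hQ := (((hasPS_operator hsum hprod ha h0).add (hasPS_const (-(β : ℂ)))).const_mul u)
  have hX' := (hX.add (hasPS_const (-(β : ℂ)))).const_mul u
  have hlt := lt_re_of_hasSum_hadamard hQ hψ hψ0 (fun w hw => by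
    simpa only [sub_eq_add_neg] using hφ w hw) hstrict hz (X := u * (X z + -β)) (by
      -- Since `psi` has constant term 1, subtracting β before or after the Hadamard product gives
      -- the same series.
      refine ((hX' z hz)).congr_fun fun m => ?_
      rcases eq_or_ne m 0 with rfl | hm
      · simp [hψ0]
      · simp only [if_neg hm]
        ring)
  simp only [hXz, Nat.cast_zero, mul_zero, add_zero, zero_add, mul_one, h1, if_true]
    at hlt
  have e1 : (u * (1 + -(β : ℂ))).re = u.re * (1 - β) := by
    simp [Complex.mul_re, sub_eq_add_neg]
  have e2 : (u * -(β : ℂ)).re = -(u.re * β) := by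
    simp [Complex.mul_re]
  rw [e1, e2] at hlt
  have e3 : (2 * (1 - 1 / (2 * (1 - β))) - 1) * (u.re * (1 - β)) = -(u.re * β) := by
    field_simp
    ring
  exact hlt.ne e3

theorem neg_half_lt_re_div_one_sub {z : ℂ} (hz : z ∈ Metric.ball (0 : ℂ) 1) :
    -(1 / 2) < (z / (1 - z)).re := by
  have hn : 0 < Complex.normSq (1 - z) := Complex.normSq_pos.2 (one_sub_ne_zero_of_mem_ball hz)
  have h1 : z.re * z.re + z.im * z.im < 1 := by
    have h2 := mem_ball_zero_iff.1 hz
    rw [← Complex.normSq_apply, Complex.normSq_eq_norm_sq]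
    nlinarith [norm_nonneg z]
  rw [Complex.div_re, ← add_div, lt_div_iff₀ hn, Complex.normSq_apply]
  simp only [Complex.sub_re, Complex.sub_im, Complex.one_re, Complex.one_im]
  nlinarith

/-- By contraposition: a value of Re `psi` below the bound yields an explicit member of W_β whose
transform has a vanishing convolution. -/
theorem le_re_psi_of_image_subset (hμ : 0 < μ) (hν : 0 < ν) (hsum : μ + ν = α - γ)
    (hprod : μ * ν = γ) (hlam : IntervalIntegrable lam volume 0 1)
    (hlam1 : ∫ t in (0 : ℝ)..1, lam t = 1) {β : ℝ} (hβ : β < 1)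
    (h : V lam '' ClassW α γ β ⊆ ClassM ξ) {ε : ℂ} (hε : ‖ε‖ = 1)
    {z : ℂ} (hz : z ∈ Metric.ball (0 : ℂ) 1) :
    1 - 1 / (2 * (1 - β)) ≤ (psi lam μ ν ξ ε z).re := by
  by_contra! hlt
  have hβ' : 0 < 1 - β := sub_pos.2 hβ
  have hψ := hasPS_psi (ξ := ξ) hμ hν hlam ε
  have hψ0 := psiCoef_zero (μ := μ) (ν := ν) (ξ := ξ) hlam1 ε
  have hψz0 : psi lam μ ν ξ ε 0 = 1 := by rw [hψ.apply_zero, hψ0]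
  have hhalf : 0 < 1 / (2 * (1 - β)) := by positivity
  -- As Re `psi` is 1 at the origin, the intermediate value theorem gives a point where it equals
  -- the bound exactly. This exactness puts the extremal operator just inside the half-plane
  -- condition.
  obtain ⟨w, hw, hwre⟩ := (((convex_ball (0 : ℂ) 1).isPreconnected.image _
    (Complex.continuous_re.comp_continuousOn hψ.differentiableOn.continuousOn))).Icc_subset
    (mem_image_of_mem _ hz) (mem_image_of_mem _ (Metric.mem_ball_self one_pos))
    (show 1 - 1 / (2 * (1 - β)) ∈ Icc (psi lam μ ν ξ ε z).re (psi lam μ ν ξ ε 0).re from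
      ⟨hlt.le, by rw [hψz0, Complex.one_re]; linarith⟩)
  have hw0 : w ≠ 0 := by
    rintro rfl
    simp only [Function.comp, hψz0, Complex.one_re] at hwre
    linarith
  set d := 1 - psi lam μ ν ξ ε w with hd
  have hdre : d.re = 1 / (2 * (1 - β)) := by
    simp only [Function.comp] at hwre
    rw [hd, Complex.sub_re, hwre, Complex.one_re]
    ring
  have hd0 : d ≠ 0 := fun h0 => by
    rw [h0, Complex.zero_re] at hdre
    linarith
  have hdn : 0 < ‖d‖ := norm_pos_iff.2 hd0
  have hdnC : (‖d‖ : ℂ) ≠ 0 := Complex.ofReal_ne_zero.2 hdn.ne'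
  -- Coefficients of 1 + z/(d(1-z)). Its Hadamard product with `psi` is 1 + (psi - 1)/d, which
  -- vanishes at `w` because psi(w) = 1 - d.
  set e : ℕ → ℂ := fun m => if m = 0 then 1 else 1 / d with he
  have heb : ∀ m, ‖e m‖ ≤ 1 + ‖1 / d‖ := fun m => by
    simp only [he]
    split_ifs
    · simp
    · linarith
  set a : ℕ → ℂ := fun n => if n = 0 then 0 else
    e (n - 1) / ((1 + μ * (n - 1 : ℕ)) * (1 + ν * (n - 1 : ℕ))) with ha
  have ha0 : a 0 = 0 := by simp [ha]
  have ha1 : a 1 = 1 := by simp [ha, he]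
  have hae : ∀ m : ℕ, (1 + μ * m) * (1 + ν * m) * a (m + 1) = e m := fun m => by
    have h1 := one_add_mul_natCast_ne_zero hμ m
    have h2 := one_add_mul_natCast_ne_zero hν m
    simp only [ha, if_neg m.succ_ne_zero, Nat.add_sub_cancel]
    rw [mul_div_cancel₀ _ (mul_ne_zero h1 h2)]
  have hab : ∀ n, ‖a n‖ ≤ 1 + ‖1 / d‖ := fun n => by
    rcases n with _ | m
    · rw [ha0, norm_zero]
      positivity
    · refine le_trans ?_ (heb m)
      rw [← hae, norm_mul]
      refine le_mul_of_one_le_left (norm_nonneg _) ?_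
      have h3 : ((1 : ℂ) + μ * m) * (1 + ν * m) = (((1 + μ * m) * (1 + ν * m) : ℝ) : ℂ) := by
        push_cast
        rfl
      rw [h3, Complex.norm_real, Real.norm_of_nonneg (by positivity)]
      refine one_le_mul_of_one_le_of_one_le ?_ ?_
      · have : 0 ≤ μ * m := by positivity
        linarith
      · have : 0 ≤ ν * m := by positivity
        linarith
  have hf := hasPS_of_bounded hab
  set f : ℂ → ℂ := fun z => ∑' n, a n * z ^ n
  have hfA : f ∈ ClassA := hf.mem_classA ha0 ha1
  have hH := (hasPS_operator hsum hprod hf ha0).congr hae fun _ _ => rfl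
  have hE : HasPS e fun z => 1 + 1 / d * (z * (1 - z)⁻¹) := by
    have h1 : HasPS (fun n => if n = 0 then 0 else 1) fun z => z * (1 - z)⁻¹ :=
      hasPS_geometric.id_mul (by simp) fun n => by simp
    refine ((hasPS_const 1).add (h1.const_mul (1 / d))).congr (fun n => ?_) fun _ _ => rfl
    simp only [he]
    split_ifs <;> simp
  have hfW : f ∈ ClassW α γ β := by
    -- The rotation must turn 1/d into a positive number. Up to the factor 1/|d| the real part is
    -- then (1-β) Re d + Re x/(1-x), where the first term is 1/2 and the second exceeds -1/2.
    refine ⟨hfA, Complex.arg d, fun x hx => ?_⟩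
    have h1 := hH.eqOn hE hx
    simp only at h1
    rw [h1]
    have h2 : Complex.exp (Complex.arg d * Complex.I) = d / ‖d‖ := by
      rw [eq_div_iff hdnC, mul_comm, Complex.norm_mul_exp_arg_mul_I]
    have h3 : d / ‖d‖ * (1 + 1 / d * (x * (1 - x)⁻¹) - β) =
        ((1 / ‖d‖ : ℝ) : ℂ) * (((1 - β : ℝ) : ℂ) * d + x / (1 - x)) := by
      have := one_sub_ne_zero_of_mem_ball hx
      push_cast
      field_simp
      ring
    rw [h2, h3, Complex.re_ofReal_mul, Complex.add_re, Complex.re_ofReal_mul, hdre]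
    have h4 := neg_half_lt_re_div_one_sub hx
    have h5 : (1 - β) * (1 / (2 * (1 - β))) = 1 / 2 := by field_simp
    rw [h5]
    exact mul_pos (by positivity) (by linarith)
  obtain ⟨X, hX, hXe⟩ := exists_pascuConv_eq (ξ := ξ) hμ hν hlam hf ha0 ε
  have hX' : HasPS (fun m => (1 + μ * m) * (1 + ν * m) * a (m + 1) * psiCoef lam μ ν ξ ε m)
      fun z => (1 - 1 / d) + 1 / d * psi lam μ ν ξ ε z := by
    refine ((hasPS_const (1 - 1 / d)).add (hψ.const_mul (1 / d))).congr (fun m => ?_)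
      fun _ _ => rfl
    rw [hae]
    rcases eq_or_ne m 0 with rfl | hm
    · simp [hψ0, he]
    · simp [he, hm]
  refine pascuConv_ne_zero_of_mem_classM (h ⟨f, hfW, rfl⟩) hε hw hw0 ?_
  have h6 : psi lam μ ν ξ ε w = 1 - d := by rw [hd]; ring
  rw [hXe, hX.eqOn hX' hw]
  simp only [h6]
  field_simp
  ring

end

end Pascu

/-! ### The main theorem -/

open Pascu in
theorem mainTheorem1 (μ ν α γ ξ β : ℝ) (hμ : 0 < μ) (hν : 0 < ν)
    (hsum : μ + ν = α - γ) (hprod : μ * ν = γ)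
    (hξ0 : 0 ≤ ξ) (hξ1 : ξ ≤ 1)
    (lam : ℝ → ℝ) (hlam0 : ∀ t ∈ Set.Icc (0 : ℝ) 1, 0 ≤ lam t)
    (hlami : IntervalIntegrable lam MeasureTheory.volume 0 1)
    (hlam1 : ∫ t in (0 : ℝ)..1, lam t = 1)
    (g q : ℝ → ℝ) (hg : IsSolG μ ν g) (hq : IsSolQ μ ν q)
    (hβ1 : β < 1)
    (hβ : β / (1 - β) =
      -∫ t in (0 : ℝ)..1, lam t * ((1 - ξ) * g t + ξ * (2 * q t - 1)))
    (hLam : Filter.Tendsto (fun t : ℝ => t ^ (1 / ν) * Lam lam ν t)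
      (nhdsWithin 0 (Set.Ioi 0)) (nhds 0))
    (hPi : Filter.Tendsto (fun t : ℝ => t ^ (1 / μ) * PiFun lam μ ν t)
      (nhdsWithin 0 (Set.Ioi 0)) (nhds 0)) :
    (V lam '' ClassW α γ β ⊆ ClassM ξ ↔
        ∀ ε : ℂ, ‖ε‖ = 1 → 0 ≤ NPi lam μ ν ξ (hfun ε)) ∧
      (∀ f ∈ ClassA, V lam f ∈ ClassM ξ ↔ pascuComb ξ (V lam f) ∈ Starlike) ∧
      (∀ β' : ℝ, β' < β → ¬ V lam '' ClassW α γ β' ⊆ ClassM ξ) := by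
  have hc := integral_koebeMin (ξ := ξ) hμ hν hlami.1 hlam1 hg hq hβ1 hβ
  refine ⟨⟨fun h ε hε => ?_, fun h => ?_⟩, fun f hf => ?_, fun β' hβ' h => ?_⟩
  · rw [nPi_nonneg_iff hμ hν hlami hc]
    exact fun z hz => le_re_psi_of_image_subset hμ hν hsum hprod hlami hlam1 hβ1 h hε hz
  · rintro _ ⟨f, hf, rfl⟩
    exact V_mem_classM_of_le_re_psi hμ hν hsum hprod hlami hlam1 hβ1
      (fun ε hε => (nPi_nonneg_iff hμ hν hlami hc ε).1 (h ε hε)) hf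
  · have hV := V_mem_classA hlami hlam1 hf
    rw [mem_classM_iff hV, starlike_iff (pascuComb_mem_classA hV)]
  -- Inclusion for β' bounds Re `psi` below by 1 - 1/(2(1-β')). The Koebe case shows that no lower
  -- bound exceeds 1 - 1/(2(1-β)), which contradicts β' < β.
  · have h1 := le_of_forall_le_re_psi hμ hν hlami hc fun z hz =>
      le_re_psi_of_image_subset hμ hν hsum hprod hlami hlam1 (hβ'.trans hβ1) h
        (ε := 1) (by simp) hz
    have h2 : 1 / (2 * (1 - β')) < 1 / (2 * (1 - β)) :=
      one_div_lt_one_div_of_lt (by linarith) (by linarith)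
    linarith
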